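/- Let $\mathcal I$ be a countable cancellative commutative semiring with a parity function, i.e. a non-trivial homomorphism $p:(\mathcal I,+)\to\mathbb Z_2$. For a finite-dimensional real $\mathcal I$-graded vector space $V=\bigoplus_i V_i$ with $V_0=0$, let $\mathrm S(V)$ be the tensor algebra of $V$ modulo the relations $v\otimes w=(-1)^{p(ij)}w\otimes v$ ($v\in V_i$, $w\in V_j$), and let $\overline{\mathrm S(V)}=\prod_{n\ge 0}\mathrm S^n(V)$. An $\mathcal I$-graded ringed space is a topological space with a sheaf of real $\mathcal I$-graded algebras whose restrictions preserve the grading. (As $\overline{\mathrm S(V)}$ may have infinitely many homogeneous components, an $\mathcal I$-grading of $A$ is understood as $\bigoplus_i A_i\subseteq A\subseteq\prod_i A_i$.) A morphism $\varphi=(\tilde\varphi,\varphi^*)$ is a morphism of ringed spaces for which $\varphi^*$ preserves the grading. An $\mathcal I$-graded domain is an open set $U\subseteq\mathbb R^n$ with the sheaf of $\overline{\mathrm S(V)}$-valued smooth functions; its canonical body map $\epsilon$ to the sheaf $C^\infty$ of smooth real functions is the projection to $\mathrm S^0(V)=\mathbb R$. An $\mathcal I$-graded manifold $\mathcal M=(M,\mathcal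 O_M)$ is a Hausdorff smooth manifold $M$ with a sheaf $\mathcal O_M$ that makes it an $\mathcal I$-graded ringed space locally isomorphic, over diffeomorphisms, to $\mathcal I$-graded domains of a fixed dimension $n|(\dim V_i)$; these isomorphisms are its charts. A smooth manifold with $C^\infty$ in degree $0$ is regarded as an $\mathcal I$-graded ringed space, and a morphism $\mathcal O_M\to C^\infty$ of sheaves of $\mathcal I$-graded rings on $M$ as a morphism $M\to\mathcal M$ that is the identity on $M$. **Proposition.** Let $\mathcal M=(M,\mathcal O_M)$ and $\mathcal N=(N,\mathcal O_N)$ be $\mathcal I$-graded manifolds. On each of them there is exactly one morphism of sheaves of $\mathcal I$-graded rings $\epsilon:\mathcal O\to C^\infty$ (the body map), and in every chart it is the canonical one. 1. For every morphism $\varphi=(\tilde\varphi,\varphi^*):\mathcal M\to\mathcal N$, every open $U\subseteq N$ and every $f\in\mathcal O_N(U)$, $$\epsilon(\varphi^*f)=\epsilon(f)\circ\tilde\varphi\quad\text{on }\tilde\varphi^{-1}(U).$$ Moreover $\tilde\varphi:M\to N$ is smooth, and $\varphi$ restricts to it on underlying manifolds: the composites $M\hookrightarrow\mathcal M\xrightarrow{\varphi}\mathcal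 N$ and $M\xrightarrow{\tilde\varphi}N\hookrightarrow\mathcal N$ are equal, where the inclusions are given by the body maps. 2. $\tilde\varphi$ is determined by $\varphi^*$: if two morphisms $\varphi,\psi:\mathcal M\to\mathcal N$ have the same pullback of global sections $\mathcal O_N(N)\to\mathcal O_M(M)$, then $\tilde\varphi=\tilde\psi$. In particular, 1 and 2 hold for morphisms of $\mathcal I$-graded domains with their canonical body maps. -/

import Mathlib

open TopologicalSpace Opposite CategoryTheory
open scoped Manifold ContDiff

noncomputable section

namespace MonoidallyGraded

universe u v w u₁ u₂ v₁ v₂ w₁ w₂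

/-! ### Graded vector spaces and graded algebras -/

/-- A finite-dimensional real `I`-graded vector space `V = ⨁ i, V i` with `V 0 = 0`
(that is, all `V i` are finite-dimensional and only finitely many are non-zero). -/
structure GradedVectorSpace (I : Type u) [Zero I] where
  carrier : Type v
  [addCommGroup : AddCommGroup carrier]
  [module : Module ℝ carrier]
  [finiteDimensional : FiniteDimensional ℝ carrier]
  grade : I → Submodule ℝ carrier
  independent : iSupIndep grade
  spans : iSup grade = ⊤
  grade_zero : grade 0 = ⊥

attribute [instance] GradedVectorSpace.addCommGroup GradedVectorSpace.module
  GradedVectorSpace.finiteDimensional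

/-- `𝒜` is an `I`-grading of the real algebra `A`: it is multiplicative and every element is
determined by its homogeneous components, i.e. `⨁ i, 𝒜 i ⊆ A ⊆ ∏ i, 𝒜 i`.
Algebras of formal power series have infinitely many non-zero homogeneous components
in general, so that `A = ⨁ i, 𝒜 i` cannot be asked for. -/
structure IsGrading {I : Type u} [AddMonoid I] {A : Type v} [Ring A] [Algebra ℝ A]
    (𝒜 : I → Submodule ℝ A) : Prop where
  one_mem : (1 : A) ∈ 𝒜 0
  mul_mem : ∀ {i j : I} {a b : A}, a ∈ 𝒜 i → b ∈ 𝒜 j → a * b ∈ 𝒜 (i + j)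
  exists_proj : ∃ π : I → A →ₗ[ℝ] A,
    (∀ i a, π i a ∈ 𝒜 i) ∧ (∀ i, ∀ a ∈ 𝒜 i, π i a = a) ∧
      (∀ i j, i ≠ j → ∀ a ∈ 𝒜 j, π i a = 0) ∧ ∀ a, (∀ i, π i a = 0) → a = 0

/-! ### The symmetric algebra and its formal completion -/

section Algebra

variable {I : Type u} [NonUnitalCommSemiring I]

/-- The sign `(-1) ^ p(ij)`. -/
def koszulSign (p : I →+ ZMod 2) (i j : I) : ℝ := if p (i * j) = 0 then 1 else -1

/-- The relations `v ⊗ w = (-1) ^ p(ij) w ⊗ v` for `v`, `w` homogeneous of degrees `i`, `j`. -/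
inductive SymRel (p : I →+ ZMod 2) (V : GradedVectorSpace.{u, v} I) :
    TensorAlgebra ℝ V.carrier → TensorAlgebra ℝ V.carrier → Prop
  | comm {i j : I} {x y : V.carrier} (hx : x ∈ V.grade i) (hy : y ∈ V.grade j) :
      SymRel p V (TensorAlgebra.ι ℝ x * TensorAlgebra.ι ℝ y)
        (koszulSign p i j • (TensorAlgebra.ι ℝ y * TensorAlgebra.ι ℝ x))

/-- The symmetric algebra `S(V)` of a graded vector space. -/
def Sym (p : I →+ ZMod 2) (V : GradedVectorSpace.{u, v} I) : Type v := RingQuot (SymRel p V)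

variable (p : I →+ ZMod 2) (V : GradedVectorSpace.{u, v} I)

instance : Ring (Sym p V) := inferInstanceAs (Ring (RingQuot (SymRel p V)))

instance : Algebra ℝ (Sym p V) := inferInstanceAs (Algebra ℝ (RingQuot (SymRel p V)))

/-- The projection of the tensor algebra onto the symmetric algebra. -/
def Sym.mk : TensorAlgebra ℝ V.carrier →ₐ[ℝ] Sym p V := RingQuot.mkAlgHom ℝ (SymRel p V)

variable {p V} in
/-- The universal property of the symmetric algebra as a quotient of the tensor algebra. -/
def Sym.lift {B : Type w} [Ring B] [Algebra ℝ B] (f : TensorAlgebra ℝ V.carrier →ₐ[ℝ] B)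
    (hf : ∀ ⦃x y⦄, SymRel p V x y → f x = f y) : Sym p V →ₐ[ℝ] B :=
  RingQuot.liftAlgHom ℝ ⟨f, hf⟩

theorem Sym.lift_mk {B : Type w} [Ring B] [Algebra ℝ B] (f : TensorAlgebra ℝ V.carrier →ₐ[ℝ] B)
    (hf : ∀ ⦃x y⦄, SymRel p V x y → f x = f y) (t : TensorAlgebra ℝ V.carrier) :
    Sym.lift f hf (Sym.mk p V t) = f t :=
  RingQuot.liftAlgHom_mkAlgHom_apply ℝ f hf t

/-- The canonical map `V → S(V)`. -/
def Sym.gen : V.carrier →ₗ[ℝ] Sym p V :=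
  (Sym.mk p V).toLinearMap ∘ₗ TensorAlgebra.ι ℝ

/-- `Sⁿ(V)`, spanned by the products of `n` elements of `V`. -/
def Sym.power (n : ℕ) : Submodule ℝ (Sym p V) := LinearMap.range (Sym.gen p V) ^ n

/-- `S(V)ₖ`, spanned by the products of homogeneous elements of `V` whose degrees add up
to `k`. -/
def Sym.homog (k : I) : Submodule ℝ (Sym p V) :=
  Submodule.span ℝ {s | ∃ l : List (I × V.carrier), (∀ q ∈ l, q.2 ∈ V.grade q.1) ∧
    (l.map Prod.fst).sum = k ∧ s = (l.map fun q => Sym.gen p V q.2).prod}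

/-- The algebra homomorphism `S(V) → ℝ` induced by the zero map `V → ℝ`. -/
def Sym.aug : Sym p V →ₐ[ℝ] ℝ :=
  Sym.lift (TensorAlgebra.lift ℝ (0 : V.carrier →ₗ[ℝ] ℝ)) (by
    rintro _ _ ⟨hx, hy⟩
    simp)

/-- The algebra `∏ n, Sⁿ(V)` of formal power series on `V`. The family `(fₙ)` is written as the
power series `∑ fₙ Tⁿ` in a central auxiliary variable `T`, so that the multiplication is
`(fg)ₙ = ∑ fᵢ gⱼ` over `i + j = n`. -/
def Formal : Subalgebra ℝ (PowerSeries (Sym p V)) where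
  carrier := {f | ∀ n, PowerSeries.coeff n f ∈ Sym.power p V n}
  add_mem' hf hg n := by
    rw [map_add]
    exact add_mem (hf n) (hg n)
  mul_mem' hf hg n := by
    rw [PowerSeries.coeff_mul]
    refine Submodule.sum_mem _ fun q hq => ?_
    rw [← Finset.HasAntidiagonal.mem_antidiagonal.mp hq, Sym.power, pow_add]
    exact Submodule.mul_mem_mul (hf _) (hg _)
  algebraMap_mem' r n := by
    rw [PowerSeries.algebraMap_apply, PowerSeries.coeff_C]
    split_ifs with h
    · subst h
      rw [Sym.power, pow_zero]
      exact Submodule.algebraMap_mem r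
    · exact zero_mem _

/-- The component of a formal power series in `Sⁿ(V)`. -/
def Formal.coeff (n : ℕ) : Formal p V →ₗ[ℝ] Sym p V :=
  ((PowerSeries.coeff n : PowerSeries (Sym p V) →ₗ[Sym p V] Sym p V).restrictScalars ℝ) ∘ₗ
    (Formal p V).val.toLinearMap

/-- The canonical body map of the algebra of formal power series: the component in `S⁰(V) = ℝ`. -/
def Formal.body : Formal p V →+* ℝ :=
  ((Sym.aug p V : Sym p V →+* ℝ).comp PowerSeries.constantCoeff).comp
    ((Formal p V).val : Formal p V →+* PowerSeries (Sym p V))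

/-- The homogeneous formal power series of degree `k`. -/
def Formal.homog (k : I) : Submodule ℝ (Formal p V) :=
  ⨅ n, (Sym.homog p V k).comap (Formal.coeff p V n)

variable {p V}

theorem Formal.ext {f g : Formal p V}
    (h : ∀ n, Formal.coeff p V n f = Formal.coeff p V n g) : f = g :=
  Subtype.ext (PowerSeries.ext h)

theorem Formal.coeff_mem (f : Formal p V) (n : ℕ) : Formal.coeff p V n f ∈ Sym.power p V n :=
  f.2 n

theorem Formal.coeff_mul (f g : Formal p V) (n : ℕ) : Formal.coeff p V n (f * g) =
    ∑ q ∈ Finset.HasAntidiagonal.antidiagonal n, Formal.coeff p V q.1 f * Formal.coeff p V q.2 g :=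
  PowerSeries.coeff_mul n _ _

theorem Formal.mem_homog {k : I} {f : Formal p V} :
    f ∈ Formal.homog p V k ↔ ∀ n, Formal.coeff p V n f ∈ Sym.homog p V k := by
  simp [Formal.homog]

theorem Formal.body_eq (f : Formal p V) :
    Formal.body p V f = Sym.aug p V (Formal.coeff p V 0 f) := by
  simp [Formal.body, Formal.coeff]

theorem Sym.one_mem_homog : (1 : Sym p V) ∈ Sym.homog p V 0 :=
  Submodule.subset_span ⟨[], by simp, by simp, by simp⟩

theorem Sym.gen_mem_homog {i : I} {x : V.carrier} (hx : x ∈ V.grade i) :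
    Sym.gen p V x ∈ Sym.homog p V i :=
  Submodule.subset_span ⟨[(i, x)], by simpa using hx, by simp, by simp⟩

theorem Sym.homog_mul_le (i j : I) :
    Sym.homog p V i * Sym.homog p V j ≤ Sym.homog p V (i + j) := by
  rw [Sym.homog, Sym.homog, Submodule.span_mul_span, Submodule.span_le]
  rintro _ ⟨_, ⟨l, hl, rfl, rfl⟩, _, ⟨l', hl', rfl, rfl⟩, rfl⟩
  refine Submodule.subset_span ⟨l ++ l', ?_, by simp, by simp⟩
  intro q hq
  rcases List.mem_append.mp hq with h | h
  exacts [hl q h, hl' q h]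

/-! The homogeneous components of an element of `S(V)` are read off from the algebra homomorphism
`S(V) → S(V)[I]` that sends a homogeneous `v` of degree `i` to `v Xⁱ`. -/

theorem exists_grade_lift (V : GradedVectorSpace.{u, v} I) {B : Type w} [AddCommGroup B]
    [Module ℝ B] (f : I → V.carrier →ₗ[ℝ] B) :
    ∃ F : V.carrier →ₗ[ℝ] B, ∀ i, ∀ x ∈ V.grade i, F x = f i x := by
  classical
  have hint : DirectSum.IsInternal V.grade :=
    DirectSum.isInternal_submodule_of_iSupIndep_of_iSup_eq_top V.independent V.spans
  let e := LinearEquiv.ofBijective (DirectSum.coeLinearMap V.grade) hint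
  refine ⟨(DirectSum.toModule ℝ I B fun i => (f i) ∘ₗ (V.grade i).subtype) ∘ₗ
    e.symm.toLinearMap, fun i x hx => ?_⟩
  have : e.symm x = DirectSum.lof ℝ I (fun i => V.grade i) i ⟨x, hx⟩ := by
    rw [LinearEquiv.symm_apply_eq]
    exact (DirectSum.coeLinearMap_lof V.grade i ⟨x, hx⟩).symm
  simp [this]

theorem grade_induction (V : GradedVectorSpace.{u, v} I) {P : V.carrier → Prop}
    (h : ∀ i, ∀ x ∈ V.grade i, P x) (h0 : P 0) (hadd : ∀ x y, P x → P y → P (x + y))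
    (x : V.carrier) : P x :=
  Submodule.iSup_induction V.grade (motive := P) (V.spans ▸ Submodule.mem_top) h h0 hadd

theorem Sym.induction {P : Sym p V → Prop} (hr : ∀ r : ℝ, P (algebraMap ℝ _ r))
    (hg : ∀ i, ∀ x ∈ V.grade i, P (Sym.gen p V x)) (hm : ∀ a b, P a → P b → P (a * b))
    (ha : ∀ a b, P a → P b → P (a + b)) (s : Sym p V) : P s := by
  obtain ⟨t, rfl⟩ : ∃ t, Sym.mk p V t = s := RingQuot.mkAlgHom_surjective ℝ (SymRel p V) s
  induction t using TensorAlgebra.induction with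
  | algebraMap r => simpa using hr r
  | ι x =>
    refine grade_induction V (P := fun x => P (Sym.mk p V (TensorAlgebra.ι ℝ x))) hg ?_ ?_ x
    · simpa using hr 0
    · intro x y hx hy
      simpa using ha _ _ hx hy
  | mul a b ha' hb' => simpa using hm _ _ ha' hb'
  | add a b ha' hb' => simpa using ha _ _ ha' hb'

theorem koszulSign_comm (p : I →+ ZMod 2) (i j : I) : koszulSign p i j = koszulSign p j i := by
  rw [koszulSign, koszulSign, mul_comm]

theorem Sym.gen_mul_gen {i j : I} {x y : V.carrier} (hx : x ∈ V.grade i) (hy : y ∈ V.grade j) :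
    Sym.gen p V x * Sym.gen p V y = koszulSign p i j • (Sym.gen p V y * Sym.gen p V x) := by
  have h : Sym.mk p V _ = Sym.mk p V _ := RingQuot.mkAlgHom_rel ℝ (SymRel.comm (p := p) hx hy)
  simpa [Sym.gen] using h

theorem Sym.exists_coaction (p : I →+ ZMod 2) (V : GradedVectorSpace.{u, v} I) :
    ∃ Δ : Sym p V →ₐ[ℝ] AddMonoidAlgebra (Sym p V) I,
      ∀ i, ∀ x ∈ V.grade i, Δ (Sym.gen p V x) = AddMonoidAlgebra.single i (Sym.gen p V x) := by
  obtain ⟨F, hF⟩ := exists_grade_lift V (B := AddMonoidAlgebra (Sym p V) I) fun i =>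
    { toFun := fun x => AddMonoidAlgebra.single i (Sym.gen p V x)
      map_add' := fun x y => by simp
      map_smul' := fun r x => by simp }
  refine ⟨Sym.lift (TensorAlgebra.lift ℝ F) ?_, fun i x hx => ?_⟩
  · rintro _ _ ⟨hx, hy⟩
    rename_i i j x y
    have h1 := hF _ _ hx
    have h2 := hF _ _ hy
    simp only [LinearMap.coe_mk, AddHom.coe_mk] at h1 h2
    simp only [map_mul, map_smul, TensorAlgebra.lift_ι_apply, h1, h2,
      AddMonoidAlgebra.single_mul_single]
    rw [Sym.gen_mul_gen hx hy, add_comm i j, AddMonoidAlgebra.smul_single]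
  · have h1 := hF _ _ hx
    simp only [LinearMap.coe_mk, AddHom.coe_mk] at h1
    simp [Sym.gen, Sym.lift_mk, h1]

theorem coeff_mul_mem {A : Type w} [Ring A] [Algebra ℝ A] {P Q R : I → Submodule ℝ A}
    (h : ∀ i j, P i * Q j ≤ R (i + j)) {a b : AddMonoidAlgebra A I}
    (ha : ∀ k, a.coeff k ∈ P k) (hb : ∀ k, b.coeff k ∈ Q k) (k : I) : (a * b).coeff k ∈ R k := by
  classical
  rw [AddMonoidAlgebra.coeff_mul]
  refine Submodule.sum_mem _ fun i _ => Submodule.sum_mem _ fun j _ => ?_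
  dsimp only
  split_ifs with hk
  · exact hk ▸ h i j (Submodule.mul_mem_mul (ha i) (hb j))
  · exact zero_mem _

theorem Sym.iSup_homog : iSup (Sym.homog p V) = ⊤ := by
  refine Submodule.eq_top_iff'.mpr fun s => ?_
  induction s using Sym.induction with
  | hr r =>
    refine Submodule.mem_iSup_of_mem 0 ?_
    rw [Algebra.algebraMap_eq_smul_one]
    exact Submodule.smul_mem _ _ Sym.one_mem_homog
  | hg i x hx => exact Submodule.mem_iSup_of_mem i (Sym.gen_mem_homog hx)
  | hm a b ha hb =>
    have hle : iSup (Sym.homog p V) * iSup (Sym.homog p V) ≤ iSup (Sym.homog p V) := by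
      rw [Submodule.iSup_mul]
      refine iSup_le fun i => ?_
      rw [Submodule.mul_iSup]
      exact iSup_le fun j => (Sym.homog_mul_le i j).trans (le_iSup _ _)
    exact hle (Submodule.mul_mem_mul ha hb)
  | ha a b ha hb => exact add_mem ha hb

theorem Sym.exists_proj (p : I →+ ZMod 2) (V : GradedVectorSpace.{u, v} I) :
    ∃ π : I → Sym p V →ₗ[ℝ] Sym p V,
      (∀ k s, π k s ∈ Sym.homog p V k) ∧ (∀ k, ∀ s ∈ Sym.homog p V k, π k s = s) ∧
      (∀ i j, i ≠ j → ∀ s ∈ Sym.homog p V j, π i s = 0) ∧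
      (∀ s, (∀ k, π k s = 0) → s = 0) ∧
      ∀ n, ∀ s ∈ Sym.power p V n, ∀ k, π k s ∈ Sym.power p V n := by
  classical
  obtain ⟨Δ, hΔ⟩ := Sym.exists_coaction p V
  have key : ∀ k, ∀ s ∈ Sym.homog p V k, Δ s = AddMonoidAlgebra.single k s := by
    intro k s hs
    induction hs using Submodule.span_induction with
    | mem s hs =>
      obtain ⟨l, hl, rfl, rfl⟩ := hs
      induction l with
      | nil => simp [AddMonoidAlgebra.one_def]
      | cons q l ih =>
        have h1 := ih fun q' hq' => hl q' (by simp [hq'])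
        have h2 := hΔ q.1 q.2 (hl q (by simp))
        simp only [List.map_cons, List.prod_cons, List.sum_cons, map_mul, h1, h2,
          AddMonoidAlgebra.single_mul_single]
    | zero => simp
    | add s t _ _ hs ht => simp [hs, ht]
    | smul r s _ hs => simp [hs]
  have hsingle : ∀ (P : I → Submodule ℝ (Sym p V)) (i : I) (s : Sym p V), s ∈ P i →
      ∀ k, (AddMonoidAlgebra.single i s).coeff k ∈ P k := by
    intro P i s hs k
    rw [AddMonoidAlgebra.coeff_single, Finsupp.single_apply]
    split_ifs with h
    · exact h ▸ hs
    · exact zero_mem _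
  refine ⟨fun k =>
    { toFun := fun s => (Δ s).coeff k
      map_add' := fun s t => by simp
      map_smul' := fun r s => by simp }, ?_, ?_, ?_, ?_, ?_⟩
  · intro k s
    change (Δ s).coeff k ∈ _
    induction s using Sym.induction generalizing k with
    | hr r =>
      rw [key 0 _ (by rw [Algebra.algebraMap_eq_smul_one]; exact
        Submodule.smul_mem _ _ Sym.one_mem_homog)]
      refine hsingle (Sym.homog p V) _ _ ?_ k
      rw [Algebra.algebraMap_eq_smul_one]
      exact Submodule.smul_mem _ _ Sym.one_mem_homog
    | hg i x hx =>
      rw [hΔ i x hx]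
      exact hsingle (Sym.homog p V) _ _ (Sym.gen_mem_homog hx) k
    | hm a b ha hb =>
      rw [map_mul]
      exact coeff_mul_mem Sym.homog_mul_le ha hb k
    | ha a b ha hb =>
      rw [map_add]
      exact add_mem (ha k) (hb k)
  · intro k s hs
    simp [key k s hs]
  · intro i j hij s hs
    simp [key j s hs, hij.symm]
  · intro s hs
    have hsum : ((Δ s).coeff.sum fun _ a => a) = s := by
      have hs' : s ∈ iSup (Sym.homog p V) := Sym.iSup_homog (p := p) (V := V) ▸ Submodule.mem_top
      clear hs
      induction hs' using Submodule.iSup_induction' with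
      | mem k s hs => simp [key k s hs]
      | zero => simp
      | add s t _ _ hs ht =>
        rw [map_add, AddMonoidAlgebra.coeff_add, Finsupp.sum_add_index' (by simp) (by simp), hs, ht]
    rw [← hsum]
    have : (Δ s).coeff = 0 := Finsupp.ext hs
    simp [this]
  · intro n s hs
    change ∀ k, (Δ s).coeff k ∈ _
    induction hs using Submodule.pow_induction_on_left' with
    | algebraMap r =>
      rw [key 0 _ (by rw [Algebra.algebraMap_eq_smul_one]; exact
        Submodule.smul_mem _ _ Sym.one_mem_homog)]
      exact hsingle (fun _ => Sym.power p V 0) _ _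
        (by rw [Sym.power, pow_zero]; exact Submodule.algebraMap_mem r)
    | add x y n hx hy h1 h2 =>
      intro k
      rw [map_add]
      exact add_mem (h1 k) (h2 k)
    | mem_mul m hm n x hx h =>
      rw [map_mul]
      refine coeff_mul_mem (P := fun _ => LinearMap.range (Sym.gen p V))
        (Q := fun _ => Sym.power p V n) (R := fun _ => Sym.power p V (n + 1))
        (fun _ _ => (pow_succ' _ n).ge) ?_ h
      obtain ⟨x, rfl⟩ := hm
      refine grade_induction V (P := fun x => ∀ k, (Δ (Sym.gen p V x)).coeff k ∈
        LinearMap.range (Sym.gen p V)) ?_ (by simp) ?_ x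
      · intro i x hx k
        rw [hΔ i x hx]
        exact hsingle (fun _ => LinearMap.range (Sym.gen p V)) _ _ ⟨x, rfl⟩ k
      · intro x y hx hy k
        rw [map_add, map_add]
        exact add_mem (hx k) (hy k)

end Algebra
/-! ### Graded ringed spaces -/

/-- An `I`-graded ringed space with underlying topological space `X`: a sheaf of real `I`-graded
algebras on `X` whose restriction maps preserve the degree. -/
structure GradedRingedSpace (I : Type u) [AddMonoid I] (X : Type u₁) [TopologicalSpace X] where
  presheaf : TopCat.Presheaf (AlgCat.{w} ℝ) (TopCat.of X)
  isSheaf : TopCat.Presheaf.IsSheaf (presheaf ⋙ forget (AlgCat.{w} ℝ))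
  grade : ∀ U : Opens X, I → Submodule ℝ (presheaf.obj (op U))
  isGrading : ∀ U : Opens X, IsGrading (grade U)
  map_mem : ∀ {U V : Opens X} (h : U ≤ V) {i : I} {f : presheaf.obj (op V)}, f ∈ grade V i →
    (presheaf.map (homOfLE h).op).hom f ∈ grade U i

namespace GradedRingedSpace

variable {I : Type u} [AddMonoid I] {X : Type u₁} [TopologicalSpace X]

/-- The algebra of sections over `U`. -/
abbrev sec (O : GradedRingedSpace.{u, w} I X) (U : Opens X) : Type w := O.presheaf.obj (op U)

/-- The restriction of sections. -/
def res (O : GradedRingedSpace.{u, w} I X) {U V : Opens X} (h : U ≤ V) : O.sec V →ₐ[ℝ] O.sec U :=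
  (O.presheaf.map (homOfLE h).op).hom

/-- The open set `W` of the open subspace `U`, as an open set of `X`. -/
def openImage (U : Opens X) (W : Opens U) : Opens X :=
  (U.isOpenEmbedding (X := TopCat.of X)).functor.obj W

theorem mem_openImage {U : Opens X} {W : Opens U} {x : X} :
    x ∈ openImage U W ↔ ∃ h : x ∈ U, (⟨x, h⟩ : U) ∈ W := by
  constructor
  · rintro ⟨y, hy, rfl⟩
    exact ⟨y.2, hy⟩
  · rintro ⟨h, hx⟩
    exact ⟨⟨x, h⟩, hx, rfl⟩

/-- The restriction of a graded ringed space to an open subspace. -/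
def restrict (O : GradedRingedSpace.{u, w} I X) (U : Opens X) : GradedRingedSpace.{u, w} I U where
  presheaf := (U.isOpenEmbedding (X := TopCat.of X)).functor.op ⋙ O.presheaf
  isSheaf := TopCat.Presheaf.isSheaf_of_isOpenEmbedding
    (U.isOpenEmbedding (X := TopCat.of X)) O.isSheaf
  grade W := O.grade (openImage U W)
  isGrading W := O.isGrading (openImage U W)
  map_mem h := O.map_mem ((U.isOpenEmbedding (X := TopCat.of X)).functor.map (homOfLE h)).le

/-- A morphism `φ = (φ̃, φ^*)` of `I`-graded ringed spaces. -/
@[ext]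
structure Hom {Y : Type u₂} [TopologicalSpace Y] (O₁ : GradedRingedSpace.{u, w₁} I X)
    (O₂ : GradedRingedSpace.{u, w₂} I Y) where
  base : C(X, Y)
  app : ∀ U : Opens Y, O₂.sec U →+* O₁.sec (Opens.comap base U)
  naturality : ∀ {U V : Opens Y} (h : U ≤ V) (f : O₂.sec V),
    app U (O₂.res h f) = O₁.res (Opens.comap_mono base h) (app V f)
  app_mem : ∀ (U : Opens Y) {i : I} {f : O₂.sec U}, f ∈ O₂.grade U i →
    app U f ∈ O₁.grade (Opens.comap base U) i

namespace Hom

variable {Y : Type u₂} [TopologicalSpace Y] {Z : Type v} [TopologicalSpace Z]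
  {O₁ : GradedRingedSpace.{u, w₁} I X} {O₂ : GradedRingedSpace.{u, w₂} I Y}
  {O₃ : GradedRingedSpace.{u, w} I Z}

/-- The composite `ψ ∘ φ`. -/
def comp (ψ : Hom O₂ O₃) (φ : Hom O₁ O₂) : Hom O₁ O₃ where
  base := ψ.base.comp φ.base
  app U := (φ.app (Opens.comap ψ.base U)).comp (ψ.app U)
  naturality h f := (congrArg (φ.app _) (ψ.naturality h f)).trans
    (φ.naturality (Opens.comap_mono ψ.base h) (ψ.app _ f))
  app_mem U _ _ hf := φ.app_mem _ (ψ.app_mem U hf)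

/-- A morphism of graded ringed spaces is an isomorphism if it is a homeomorphism together with an
isomorphism of sheaves of graded rings. -/
structure IsIso (φ : Hom O₁ O₂) : Prop where
  isHomeomorph : IsHomeomorph φ.base
  bijective : ∀ U : Opens Y, Function.Bijective (φ.app U)
  mem_of_app_mem : ∀ (U : Opens Y) {i : I} {f : O₂.sec U},
    φ.app U f ∈ O₁.grade (Opens.comap φ.base U) i → f ∈ O₂.grade U i

/-- The pullback of global sections. -/
def globalPullback (φ : Hom O₁ O₂) : O₂.sec ⊤ →+* O₁.sec ⊤ := φ.app ⊤

end Hom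

end GradedRingedSpace

/-! ### Sheaves of smooth functions -/

section FunctionSheaf

variable {X : Type u₁} [TopologicalSpace X] {A : Type v} [Ring A] [Algebra ℝ A]

/-- The presheaf of algebras of `A`-valued functions subject to conditions that are stable under
restriction. -/
def functionPresheaf (S : ∀ U : Opens X, Subalgebra ℝ (U → A))
    (hS : ∀ {U V : Opens X} (h : U ≤ V) (f : V → A), f ∈ S V → f ∘ Opens.inclusion h ∈ S U) :
    TopCat.Presheaf (AlgCat.{max u₁ v} ℝ) (TopCat.of X) where
  obj U := AlgCat.of ℝ (S U.unop)
  map i := AlgCat.ofHom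
    { toFun := fun f => ⟨f.1 ∘ Opens.inclusion i.unop.le, hS i.unop.le f.1 f.2⟩
      map_one' := rfl
      map_mul' := fun _ _ => rfl
      map_zero' := rfl
      map_add' := fun _ _ => rfl
      commutes' := fun _ => rfl }
  map_id _ := rfl
  map_comp _ _ := rfl

theorem functionPresheaf_isSheaf (S : ∀ U : Opens X, Subalgebra ℝ (U → A))
    (hS : ∀ {U V : Opens X} (h : U ≤ V) (f : V → A), f ∈ S V → f ∘ Opens.inclusion h ∈ S U)
    (hloc : ∀ {U : Opens X} (f : U → A), (∀ x : U, ∃ (V : Opens X) (_ : x.1 ∈ V) (h : V ≤ U),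
      f ∘ Opens.inclusion h ∈ S V) → f ∈ S U) :
    TopCat.Presheaf.IsSheaf (functionPresheaf S hS ⋙ forget (AlgCat.{max u₁ v} ℝ)) := by
  let P : TopCat.LocalPredicate (X := TopCat.of X) fun _ => A :=
    { pred := fun {U} f => f ∈ S U
      res := fun i f hf => hS i.le f hf
      locality := fun f hf => hloc f fun x => by
        obtain ⟨V, hx, i, h⟩ := hf x
        exact ⟨V, hx, i.le, h⟩ }
  exact TopCat.subpresheafToTypes.isSheaf P

end FunctionSheaf

section Smooth

variable {I : Type u} [NonUnitalCommSemiring I] (n : ℕ) (M : Type u₁) [TopologicalSpace M]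
  [ChartedSpace (EuclideanSpace ℝ (Fin n)) M]

variable {n M} in
theorem contMDiff_of_locally {U : Opens M} (f : U → ℝ)
    (h : ∀ x : U, ∃ (V : Opens M) (_ : x.1 ∈ V) (h : V ≤ U),
      ContMDiff (𝓡 n) 𝓘(ℝ, ℝ) ∞ (f ∘ Opens.inclusion h)) : ContMDiff (𝓡 n) 𝓘(ℝ, ℝ) ∞ f := by
  intro x
  obtain ⟨V, hx, hVU, hV⟩ := h x
  exact ((contDiffWithinAt_localInvariantProp ∞).liftPropAt_iff_comp_inclusion hVU f
    ⟨x.1, hx⟩).mpr (hV ⟨x.1, hx⟩)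

/-- The algebra of smooth real functions on `U`. -/
def smoothFunctions (U : Opens M) : Subalgebra ℝ (U → ℝ) where
  carrier := {f | ContMDiff (𝓡 n) 𝓘(ℝ, ℝ) ∞ f}
  mul_mem' hf hg := hf.mul hg
  add_mem' hf hg := hf.add hg
  algebraMap_mem' _ := contMDiff_const

open Classical in
variable (I) in
/-- A manifold `M` with its sheaf of smooth real functions, all of degree `0`. -/
def smoothSpace : GradedRingedSpace.{u, u₁} I M where
  presheaf := functionPresheaf (smoothFunctions n M)
    fun h _ hf => ContMDiff.comp (I' := 𝓡 n) hf (contMDiff_inclusion h)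
  isSheaf := functionPresheaf_isSheaf _ _ fun f hf => contMDiff_of_locally f hf
  grade U i := (if i = 0 then ⊤ else ⊥ : Submodule ℝ (smoothFunctions n M U))
  isGrading U := by
    refine IsGrading.mk (A := smoothFunctions n M U) (by simp) ?_ ?_
    · intro i j a b ha hb
      by_cases hi : i = 0
      · by_cases hj : j = 0
        · simp [hi, hj]
        · have : b = 0 := by simpa [hj] using hb
          simp [this]
      · have : a = 0 := by simpa [hi] using ha
        simp [this]
    · refine ⟨fun i => if i = 0 then LinearMap.id else 0, ?_, ?_, ?_, ?_⟩
      · intro i a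
        by_cases h : i = 0 <;> simp [h]
      · intro i a ha
        by_cases h : i = 0
        · simp [h]
        · simpa [h, eq_comm] using ha
      · intro i j hij a ha
        by_cases h : i = 0
        · have hj : j ≠ 0 := fun h' => hij (h.trans h'.symm)
          simpa [h, hj] using ha
        · simp [h]
      · intro a ha
        simpa using ha 0
  map_mem {U V} h {i f} hf := by
    change f ∈ (if i = 0 then ⊤ else ⊥ : Submodule ℝ (smoothFunctions n M V)) at hf
    by_cases hi : i = 0
    · rw [if_pos hi]
      trivial
    · rw [if_neg hi] at hf ⊢
      have hf' : f = 0 := hf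
      rw [hf', map_zero]
      exact zero_mem (⊥ : Submodule ℝ (smoothFunctions n M U))

variable (p : I →+ ZMod 2) (V : GradedVectorSpace.{u, v} I)

variable {M p V} in
/-- A function with values in the algebra of formal power series on `V` is smooth if its
components in the finite-dimensional spaces `Sᵏ(V)` are smooth, that is, become smooth real
functions under all linear functionals. -/
def IsSmooth {U : Opens M} (f : U → Formal p V) : Prop :=
  ∀ (k : ℕ) (l : Module.Dual ℝ (Sym p V)),
    ContMDiff (𝓡 n) 𝓘(ℝ, ℝ) ∞ fun x => l (Formal.coeff p V k (f x))

variable {p V} in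
theorem Sym.power_fg (k : ℕ) : (Sym.power p V k).FG := by
  refine Submodule.FG.pow ?_ k
  rw [LinearMap.range_eq_map]
  exact Module.Finite.fg_top.map _

theorem exists_coordinates {A : Type v} [AddCommGroup A] [Module ℝ A] {P : Submodule ℝ A}
    (hP : P.FG) : ∃ (r : ℕ) (e : Fin r → A) (l : Fin r → Module.Dual ℝ A),
      ∀ s ∈ P, s = ∑ j, l j s • e j := by
  have : Module.Finite ℝ P := Module.Finite.iff_fg.mpr hP
  let b := Module.finBasis ℝ P
  choose l hl using fun j => LinearMap.exists_extend (b.coord j)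
  refine ⟨_, fun j => b j, l, fun s hs => ?_⟩
  have h1 : ∀ j, l j s = b.repr ⟨s, hs⟩ j := fun j =>
    LinearMap.congr_fun (hl j) (⟨s, hs⟩ : P)
  have h2 := congrArg P.subtype (b.sum_repr ⟨s, hs⟩)
  rw [map_sum] at h2
  simp only [h1]
  exact h2.symm

variable {n M p V} in
theorem IsSmooth.mul {U : Opens M} {f g : U → Formal p V} (hf : IsSmooth n f) (hg : IsSmooth n g) :
    IsSmooth n (f * g) := by
  intro k l
  have h : ∀ x, l (Formal.coeff p V k ((f * g) x)) =
      ∑ q ∈ Finset.HasAntidiagonal.antidiagonal k,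
        l (Formal.coeff p V q.1 (f x) * Formal.coeff p V q.2 (g x)) := by
    intro x
    rw [Pi.mul_apply, Formal.coeff_mul, map_sum]
  simp only [h]
  refine contMDiff_finsetSum fun q _ => ?_
  obtain ⟨r, e, a, he⟩ := exists_coordinates (Sym.power_fg (p := p) (V := V) q.1)
  obtain ⟨r', e', a', he'⟩ := exists_coordinates (Sym.power_fg (p := p) (V := V) q.2)
  have h' : ∀ x, l (Formal.coeff p V q.1 (f x) * Formal.coeff p V q.2 (g x)) =
      ∑ i, ∑ j, a i (Formal.coeff p V q.1 (f x)) * a' j (Formal.coeff p V q.2 (g x)) *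
        l (e i * e' j) := by
    intro x
    conv_lhs => rw [he _ (Formal.coeff_mem (f x) q.1), he' _ (Formal.coeff_mem (g x) q.2)]
    simp [Finset.sum_mul_sum, mul_assoc, mul_left_comm]
  simp only [h']
  exact contMDiff_finsetSum fun i _ => contMDiff_finsetSum fun j _ =>
    ((hf _ _).mul (hg _ _)).mul contMDiff_const

/-- The algebra of smooth functions on `U` with values in the formal power series on `V`. -/
def smoothFormalFunctions (U : Opens M) : Subalgebra ℝ (U → Formal p V) where
  carrier := {f | IsSmooth n f}
  mul_mem' hf hg := hf.mul hg
  add_mem' hf hg k l := by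
    simp only [Pi.add_apply, map_add]
    exact (hf k l).add (hg k l)
  algebraMap_mem' r k l := by
    change ContMDiff (𝓡 n) 𝓘(ℝ, ℝ) ∞ fun _ => l (Formal.coeff p V k (algebraMap ℝ _ r))
    exact contMDiff_const

/-- The smooth functions with values in the homogeneous formal power series of degree `i`. -/
def smoothFormalGrade (U : Opens M) (i : I) : Submodule ℝ (smoothFormalFunctions n M p V U) where
  carrier := {f | ∀ x, f.1 x ∈ Formal.homog p V i}
  add_mem' hf hg x := add_mem (hf x) (hg x)
  zero_mem' _ := zero_mem _
  smul_mem' r _ hf x := Submodule.smul_mem _ r (hf x)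

theorem Formal.exists_proj : ∃ π : I → Formal p V →ₗ[ℝ] Formal p V,
    (∀ i f, π i f ∈ Formal.homog p V i) ∧ (∀ i, ∀ f ∈ Formal.homog p V i, π i f = f) ∧
      (∀ i j, i ≠ j → ∀ f ∈ Formal.homog p V j, π i f = 0) ∧ (∀ f, (∀ i, π i f = 0) → f = 0) ∧
      ∀ i k, ∃ P : Sym p V →ₗ[ℝ] Sym p V, ∀ f,
        Formal.coeff p V k (π i f) = P (Formal.coeff p V k f) := by
  obtain ⟨π, h1, h2, h3, h4, h5⟩ := Sym.exists_proj p V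
  let ρ : I → Formal p V →ₗ[ℝ] Formal p V := fun i =>
    { toFun := fun f => ⟨PowerSeries.mk fun k => π i (Formal.coeff p V k f), fun k => by
        rw [PowerSeries.coeff_mk]
        exact h5 k _ (Formal.coeff_mem f k) i⟩
      map_add' := fun f g => Subtype.ext (by ext; simp)
      map_smul' := fun r f => Subtype.ext (by ext; simp) }
  have hρ : ∀ i k f, Formal.coeff p V k (ρ i f) = π i (Formal.coeff p V k f) := fun i k f =>
    PowerSeries.coeff_mk k fun k => π i (Formal.coeff p V k f)
  refine ⟨ρ, ?_, ?_, ?_, ?_, fun i k => ⟨π i, hρ i k⟩⟩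
  · intro i f
    rw [Formal.mem_homog]
    intro k
    rw [hρ]
    exact h1 i _
  · intro i f hf
    refine Formal.ext fun k => ?_
    rw [hρ]
    exact h2 i _ (Formal.mem_homog.mp hf k)
  · intro i j hij f hf
    refine Formal.ext fun k => ?_
    rw [hρ, map_zero]
    exact h3 i j hij _ (Formal.mem_homog.mp hf k)
  · intro f hf
    refine Formal.ext fun k => ?_
    rw [map_zero]
    refine h4 _ fun i => ?_
    rw [← hρ, hf i, map_zero]

theorem smoothFormalGrade_isGrading (U : Opens M) : IsGrading (A := smoothFormalFunctions n M p V U) (smoothFormalGrade n M p V U) where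
  one_mem _ := Formal.mem_homog.mpr fun k => by
    have h : Formal.coeff p V k 1 = if k = 0 then 1 else 0 := PowerSeries.coeff_one k
    change Formal.coeff p V k 1 ∈ _
    rw [h]
    split_ifs
    · exact Sym.one_mem_homog
    · exact zero_mem _
  mul_mem {i j a b} ha hb x := Formal.mem_homog.mpr fun k => by
    change Formal.coeff p V k (a.1 x * b.1 x) ∈ _
    rw [Formal.coeff_mul]
    exact Submodule.sum_mem _ fun q _ => Sym.homog_mul_le i j (Submodule.mul_mem_mul
      (Formal.mem_homog.mp (ha x) _) (Formal.mem_homog.mp (hb x) _))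
  exists_proj := by
    obtain ⟨π, h1, h2, h3, h4, h5⟩ := Formal.exists_proj p V
    refine ⟨fun i =>
      { toFun := fun f => ⟨fun x => π i (f.1 x), fun k l => by
          obtain ⟨P, hP⟩ := h5 i k
          simp only [hP]
          exact f.2 k (l ∘ₗ P)⟩
        map_add' := fun f g => Subtype.ext (funext fun x => map_add (π i) _ _)
        map_smul' := fun r f => Subtype.ext (funext fun x => map_smul (π i) _ _) }, ?_, ?_, ?_, ?_⟩
    · exact fun i f x => h1 i _
    · exact fun i f hf => Subtype.ext (funext fun x => h2 i _ (hf x))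
    · exact fun i j hij f hf => Subtype.ext (funext fun x => h3 i j hij _ (hf x))
    · exact fun f hf => Subtype.ext (funext fun x => h4 _ fun i =>
        congrFun (congrArg Subtype.val (hf i)) x)

/-- A manifold `M` with the sheaf of smooth functions with values in the formal power series
on `V`. -/
def smoothFormalSpace : GradedRingedSpace.{u, max u₁ v} I M where
  presheaf := functionPresheaf (A := Formal p V) (smoothFormalFunctions n M p V)
    fun {U W} h f (hf : IsSmooth n f) k l =>
      ContMDiff.comp (I' := 𝓡 n) (g := fun x => l (Formal.coeff p V k (f x))) (hf k l)
        (contMDiff_inclusion h)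
  isSheaf := functionPresheaf_isSheaf (A := Formal p V) _ _ fun f hf k l =>
    contMDiff_of_locally _ fun x => by
    obtain ⟨V, hx, h, hV⟩ := hf x
    exact ⟨V, hx, h, hV k l⟩
  grade := smoothFormalGrade n M p V
  isGrading := smoothFormalGrade_isGrading n M p V
  map_mem _ _ _ hf _ := hf _

end Smooth

/-! ### Body maps, graded domains and graded manifolds -/

section Body

variable {I : Type u} [NonUnitalCommSemiring I]

/-- A morphism `O → C^∞` of sheaves of graded rings on the manifold `M`: the datum that makes `M`
an underlying manifold of `(M, O)`. -/
@[ext]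
structure BodyMap (n : ℕ) {M : Type u₁} [TopologicalSpace M]
    [ChartedSpace (EuclideanSpace ℝ (Fin n)) M] (O : GradedRingedSpace.{u, w} I M) where
  app : ∀ U : Opens M, O.sec U →+* (smoothSpace I n M).sec U
  naturality : ∀ {U V : Opens M} (h : U ≤ V) (f : O.sec V),
    app U (O.res h f) = (smoothSpace I n M).res h (app V f)
  app_mem : ∀ (U : Opens M) {i : I} {f : O.sec U}, f ∈ O.grade U i →
    app U f ∈ (smoothSpace I n M).grade U i

section

variable {n : ℕ} {M : Type u₁} [TopologicalSpace M] [ChartedSpace (EuclideanSpace ℝ (Fin n)) M]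

/-- The value at `x ∈ U` of the image of a section `f` over `U`. -/
def BodyMap.val {O : GradedRingedSpace.{u, w} I M} (ε : BodyMap n O) {U : Opens M} (f : O.sec U)
    (x : M) (hx : x ∈ U) : ℝ :=
  (show smoothFunctions n M U from ε.app U f).1 ⟨x, hx⟩

/-- A morphism `O → C^∞` as a morphism `M → (M, O)` of graded ringed spaces that is the identity
on `M`. -/
def BodyMap.embedding {O : GradedRingedSpace.{u, w} I M} (ε : BodyMap n O) :
    GradedRingedSpace.Hom (smoothSpace I n M) O where
  base := ContinuousMap.id M
  app := ε.app
  naturality := ε.naturality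
  app_mem := ε.app_mem

/-- A smooth map of manifolds as a morphism of graded ringed spaces. -/
def smoothHom {n' : ℕ} {N : Type u₂} [TopologicalSpace N]
    [ChartedSpace (EuclideanSpace ℝ (Fin n')) N] (φ : C(M, N))
    (hφ : ContMDiff (𝓡 n) (𝓡 n') ∞ φ) :
    GradedRingedSpace.Hom (smoothSpace I n M) (smoothSpace I n' N) where
  base := φ
  app U :=
    { toFun := fun f => (⟨fun x => (show smoothFunctions n' N U from f).1 ⟨φ x.1, x.2⟩, by
        refine ContMDiff.comp (I' := 𝓡 n') (show smoothFunctions n' N U from f).2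
          (f := fun x : Opens.comap φ U => (⟨φ x.1, x.2⟩ : U)) ?_
        rw [← ContMDiff.subtypeVal_comp_iff]
        exact hφ.comp contMDiff_subtype_val⟩ : smoothFunctions n M (Opens.comap φ U))
      map_one' := rfl
      map_mul' := fun _ _ => rfl
      map_zero' := rfl
      map_add' := fun _ _ => rfl }
  naturality _ _ := rfl
  app_mem U i f hf := by
    classical
    change f ∈ (if i = 0 then ⊤ else ⊥ : Submodule ℝ (smoothFunctions n' N U)) at hf
    change _ ∈ (if i = 0 then ⊤ else ⊥ : Submodule ℝ (smoothFunctions n M (Opens.comap φ U)))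
    by_cases hi : i = 0
    · rw [if_pos hi]
      trivial
    · rw [if_neg hi] at hf ⊢
      have hf' : f = 0 := hf
      rw [hf', map_zero]
      exact zero_mem (⊥ : Submodule ℝ (smoothFunctions n M (Opens.comap φ U)))

end

theorem Formal.body_eq_zero {p : I →+ ZMod 2} {V : GradedVectorSpace.{u, v} I} {i : I}
    (hi : i ≠ 0) {f : Formal p V} (hf : f ∈ Formal.homog p V i) : Formal.body p V f = 0 := by
  rw [Formal.body_eq]
  have h0 := Formal.mem_homog.mp hf 0
  generalize Formal.coeff p V 0 f = s at h0
  induction h0 using Submodule.span_induction with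
  | mem s hs =>
    obtain ⟨l, hl, rfl, rfl⟩ := hs
    cases l with
    | nil => simp at hi
    | cons q l => simp [Sym.aug, Sym.gen, Sym.lift_mk]
  | zero => simp
  | add s t _ _ hs ht => simp [hs, ht]
  | smul r s _ hs => simp [hs]

/-- The canonical body map of the sheaf of smooth functions with values in the formal power series
on `V`. -/
def canonicalBody (n : ℕ) (M : Type u₁) [TopologicalSpace M]
    [ChartedSpace (EuclideanSpace ℝ (Fin n)) M] (p : I →+ ZMod 2)
    (V : GradedVectorSpace.{u, v} I) : BodyMap n (smoothFormalSpace n M p V) where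
  app U :=
    { toFun := fun f => (⟨fun x =>
        Formal.body p V ((show smoothFormalFunctions n M p V U from f).1 x), by
          have h := (show smoothFormalFunctions n M p V U from f).2 0 (Sym.aug p V).toLinearMap
          change ContMDiff (𝓡 n) 𝓘(ℝ, ℝ) ∞ _
          simp only [Formal.body_eq]
          exact h⟩ : smoothFunctions n M U)
      map_one' := Subtype.ext (funext fun _ => map_one (Formal.body p V))
      map_mul' := fun _ _ => Subtype.ext (funext fun _ => map_mul (Formal.body p V) _ _)
      map_zero' := Subtype.ext (funext fun _ => map_zero (Formal.body p V))
      map_add' := fun _ _ => Subtype.ext (funext fun _ => map_add (Formal.body p V) _ _) }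
  naturality _ _ := rfl
  app_mem U i f hf := by
    classical
    change _ ∈ (if i = 0 then ⊤ else ⊥ : Submodule ℝ (smoothFunctions n M U))
    by_cases hi : i = 0
    · rw [if_pos hi]
      trivial
    · rw [if_neg hi]
      exact (Submodule.mem_bot ℝ).mpr (Subtype.ext (funext fun x => Formal.body_eq_zero hi (hf x)))

variable {n : ℕ} {M : Type u₁} [TopologicalSpace M] [ChartedSpace (EuclideanSpace ℝ (Fin n)) M]

/-- The `I`-graded domain with underlying open set `D ⊆ ℝⁿ` and fibre `V`. -/
abbrev gradedDomain (p : I →+ ZMod 2) (V : GradedVectorSpace.{u, v} I)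
    (D : Opens (EuclideanSpace ℝ (Fin n))) : GradedRingedSpace.{u, v} I D :=
  smoothFormalSpace n D p V

/-- A chart of the graded ringed space `(M, O)`: an isomorphism of an open part of it with a graded
domain, whose underlying map is compatible with the smooth structure of `M`. -/
structure GradedChart (p : I →+ ZMod 2) (V : GradedVectorSpace.{u, v} I)
    (O : GradedRingedSpace.{u, w} I M) where
  source : Opens M
  target : Opens (EuclideanSpace ℝ (Fin n))
  map : GradedRingedSpace.Hom (O.restrict source) (gradedDomain p V target)
  isIso : map.IsIso
  isDiffeo : ∃ e : Diffeomorph (𝓡 n) (𝓡 n) source target ∞, ⇑e = map.base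

/-- `(M, O)` is an `I`-graded manifold of dimension `n | (dim Vᵢ)`. -/
def IsGradedManifold (p : I →+ ZMod 2) (V : GradedVectorSpace.{u, v} I)
    (O : GradedRingedSpace.{u, w} I M) : Prop :=
  ∀ x : M, ∃ c : GradedChart (n := n) p V O, x ∈ c.source

/-- The morphism `ε : O → C^∞` is the body map of the graded manifold `(M, O)`: in every chart it
is the canonical body map of the graded domain. -/
def BodyMap.IsCanonical (p : I →+ ZMod 2) (V : GradedVectorSpace.{u, v} I)
    {O : GradedRingedSpace.{u, w} I M} (ε : BodyMap n O) : Prop :=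
  ∀ (c : GradedChart (n := n) p V O) (W : Opens c.target) (g : (gradedDomain p V c.target).sec W)
    (x : c.source) (hx : c.map.base x ∈ W),
    ε.val (U := GradedRingedSpace.openImage c.source (Opens.comap c.map.base W)) (c.map.app W g) x
        (GradedRingedSpace.mem_openImage.mpr ⟨x.2, hx⟩) =
      (canonicalBody n c.target p V).val g (c.map.base x) hx

end Body

end MonoidallyGraded

end

open MonoidallyGraded GradedRingedSpace TopologicalSpace
open scoped Manifold ContDiff

/-!
A formal power series on `V` whose component in `S⁰(V) = ℝ` is nonzero is invertible, by the
geometric series, and so is a section of a graded domain with nowhere vanishing body. If `χ` is a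
ring homomorphism from the stalk at `x` to `ℝ`, then `f - χ(f)` is therefore not invertible near
`x`, which forces `χ(f)` to be the value of the body of `f` at `x`. So every stalk of a graded
manifold has exactly one such character; the body map is the evaluation of these characters, and it
commutes with pullbacks because a morphism carries characters to characters. Pulling back coordinate
functions shows that the underlying map of a morphism is smooth, and bump functions, extended by
zero from a chart, are global sections whose bodies separate the points.
-/

noncomputable section

namespace MonoidallyGraded

universe u v w u₁ u₂ w₁ w₂

namespace GradedRingedSpace

section

variable {I : Type u} [AddMonoid I] {X : Type u₁} [TopologicalSpace X]
  (O : GradedRingedSpace.{u, w} I X)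

theorem res_res {U V W : Opens X} (hUV : U ≤ V) (hVW : V ≤ W) (f : O.sec W) :
    O.res hUV (O.res hVW f) = O.res (hUV.trans hVW) f :=
  (congrArg (fun g => g.hom f)
    (O.presheaf.map_comp (homOfLE hVW).op (homOfLE hUV).op)).symm

theorem res_self {U : Opens X} (h : U ≤ U) (f : O.sec U) : O.res h f = f :=
  congrArg (fun g => g.hom f) (O.presheaf.map_id (op U))

theorem res_bijective {U V : Opens X} (hUV : U ≤ V) (hVU : V ≤ U) :
    Function.Bijective (O.res hUV) :=
  Function.bijective_iff_has_inverse.mpr ⟨O.res hVU,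
    fun f => (O.res_res _ _ f).trans (O.res_self _ f),
    fun f => (O.res_res _ _ f).trans (O.res_self _ f)⟩

variable {O} in
theorem exists_glue {U V : Opens X} (hUV : U ⊔ V = ⊤) (s : O.sec U) (t : O.sec V)
    (hst : O.res (inf_le_left : U ⊓ V ≤ U) s = O.res (inf_le_right : U ⊓ V ≤ V) t) :
    ∃ r : O.sec ⊤, O.res le_top r = s ∧ O.res le_top r = t := by
  let cover : ULift.{u₁} Bool → Opens (TopCat.of X) := fun
    | ⟨true⟩ => U
    | ⟨false⟩ => V
  have iSup_cover : iSup cover = ⊤ :=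
    top_le_iff.mp (hUV.ge.trans (sup_le (le_iSup cover ⟨true⟩) (le_iSup cover ⟨false⟩)))
  obtain ⟨r, hr, -⟩ := (TopCat.Presheaf.isSheaf_iff_isSheafUniqueGluing_types _).mp O.isSheaf
    cover (fun
      | ⟨true⟩ => s
      | ⟨false⟩ => t) (by
    rintro ⟨_ | _⟩ ⟨_ | _⟩
    · rfl
    · have := congrArg (O.res (inf_comm V U).le) hst.symm
      rwa [O.res_res, O.res_res] at this
    · exact hst
    · rfl)
  refine ⟨O.res iSup_cover.ge r, ?_, ?_⟩
  · exact (O.res_res _ _ r).trans (hr ⟨true⟩)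
  · exact (O.res_res _ _ r).trans (hr ⟨false⟩)

theorem openImage_mono {U : Opens X} {W W' : Opens U} (h : W ≤ W') :
    openImage U W ≤ openImage U W' :=
  ((U.isOpenEmbedding (X := TopCat.of X)).functor.map (homOfLE h)).le

theorem openImage_comap_val_le (U V : Opens X) :
    openImage U (Opens.comap ⟨Subtype.val, continuous_subtype_val⟩ V) ≤ V := fun _ hx =>
  (mem_openImage.mp hx).2

/-- The inclusion of an open subspace, as a morphism of graded ringed spaces. -/
def Hom.ofRestrict (U : Opens X) : Hom (O.restrict U) O where
  base := ⟨Subtype.val, continuous_subtype_val⟩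
  app V := (O.res (openImage_comap_val_le U V)).toRingHom
  naturality h f :=
    (O.res_res _ h f).trans (O.res_res (openImage_mono (Opens.comap_mono _ h)) _ f).symm
  app_mem _ _ _ hf := O.map_mem _ hf

theorem Hom.isIso_ofRestrict_top : (Hom.ofRestrict O ⊤).IsIso where
  isHomeomorph := (Homeomorph.Set.univ X).isHomeomorph
  bijective V := O.res_bijective _ fun _ hx => mem_openImage.mpr ⟨trivial, hx⟩
  mem_of_app_mem V i f hf := by
    have le_openImage : V ≤ openImage ⊤ (Opens.comap ⟨Subtype.val, continuous_subtype_val⟩ V) :=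
      fun _ hx => mem_openImage.mpr ⟨trivial, hx⟩
    have := O.map_mem le_openImage hf
    exact O.res_self le_rfl f ▸ O.res_res le_openImage (openImage_comap_val_le ⊤ V) f ▸ this

end

namespace Hom.IsIso

variable {I : Type u} [AddMonoid I] {X : Type u₁} [TopologicalSpace X] {Y : Type u₂}
  [TopologicalSpace Y] {O₁ : GradedRingedSpace.{u, w₁} I X} {O₂ : GradedRingedSpace.{u, w₂} I Y}
  {φ : Hom O₁ O₂} (hφ : φ.IsIso)

/-- The continuous inverse of the map underlying an isomorphism of graded ringed spaces. -/
def invBase : C(Y, X) :=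
  ⟨hφ.isHomeomorph.homeomorph.symm, hφ.isHomeomorph.homeomorph.symm.continuous⟩

theorem invBase_base (x : X) : hφ.invBase (φ.base x) = x :=
  hφ.isHomeomorph.homeomorph.symm_apply_apply x

theorem comap_base_comap_invBase_le (U : Opens X) :
    Opens.comap φ.base (Opens.comap hφ.invBase U) ≤ U := fun x hx =>
  hφ.invBase_base x ▸ (show hφ.invBase (φ.base x) ∈ U from hx)

/-- The pullback along the inverse of an isomorphism of graded ringed spaces. -/
def invApp (U : Opens X) : O₁.sec U →+* O₂.sec (Opens.comap hφ.invBase U) :=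
  (RingEquiv.ofBijective (φ.app (Opens.comap hφ.invBase U)) (hφ.bijective _)).symm.toRingHom.comp
    (O₁.res (hφ.comap_base_comap_invBase_le U)).toRingHom

theorem app_invApp (U : Opens X) (f : O₁.sec U) :
    φ.app _ (hφ.invApp U f) = O₁.res (hφ.comap_base_comap_invBase_le U) f :=
  (RingEquiv.ofBijective (φ.app (Opens.comap hφ.invBase U)) (hφ.bijective _)).apply_symm_apply _

/-- The inverse of an isomorphism of graded ringed spaces. -/
def inv : Hom O₂ O₁ where
  base := hφ.invBase
  app := hφ.invApp
  naturality h f := (hφ.bijective _).injective <| by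
    rw [app_invApp, φ.naturality, app_invApp, O₁.res_res, O₁.res_res]
  app_mem U i f hf := hφ.mem_of_app_mem _ <| by
    rw [app_invApp]
    exact O₁.map_mem _ hf

end Hom.IsIso

/-- A ring homomorphism from the stalk of `O` at `x` to `ℝ`, given by its values on the sections
over the neighbourhoods of `x`. -/
@[ext]
structure StalkCharacter {I : Type u} [AddMonoid I] {X : Type u₁} [TopologicalSpace X]
    (O : GradedRingedSpace.{u, w} I X) (x : X) where
  eval : ∀ U : Opens X, x ∈ U → O.sec U →+* ℝ
  eval_res : ∀ {U V : Opens X} (h : U ≤ V) (hx : x ∈ U) (f : O.sec V),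
    eval U hx (O.res h f) = eval V (h hx) f

namespace StalkCharacter

variable {I : Type u} [AddMonoid I] {X : Type u₁} [TopologicalSpace X]

theorem eval_algebraMap {O : GradedRingedSpace.{u, w} I X} {x : X} (χ : StalkCharacter O x)
    (U : Opens X) (hx : x ∈ U) (r : ℝ) : χ.eval U hx (algebraMap ℝ (O.sec U) r) = r :=
  RingHom.congr_fun
    (Subsingleton.elim ((χ.eval U hx).comp (algebraMap ℝ (O.sec U))) (RingHom.id ℝ)) r

/-- The image of a character under a morphism of graded ringed spaces. -/
def map {Y : Type u₂} [TopologicalSpace Y] {O₁ : GradedRingedSpace.{u, w₁} I X}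
    {O₂ : GradedRingedSpace.{u, w₂} I Y} (φ : Hom O₁ O₂) {x : X} (χ : StalkCharacter O₁ x) :
    StalkCharacter O₂ (φ.base x) where
  eval U hx := (χ.eval (Opens.comap φ.base U) hx).comp (φ.app U)
  eval_res h hx f := (congrArg _ (φ.naturality h f)).trans
    (χ.eval_res (Opens.comap_mono φ.base h) hx (φ.app _ f))

/-- The character of the restriction of `O` to an open subspace induced by a character of `O`. -/
def restrict {O : GradedRingedSpace.{u, w} I X} {U : Opens X} {x : U}
    (χ : StalkCharacter O x.1) : StalkCharacter (O.restrict U) x where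
  eval W hx := χ.eval (openImage U W) (mem_openImage.mpr ⟨x.2, hx⟩)
  eval_res h _ f := χ.eval_res (openImage_mono h) _ f

end StalkCharacter

end GradedRingedSpace

section Formal

variable {I : Type u} [NonUnitalCommSemiring I] {p : I →+ ZMod 2} {V : GradedVectorSpace.{u, v} I}

theorem Formal.coeff_one (k : ℕ) : Formal.coeff p V k 1 = if k = 0 then 1 else 0 :=
  PowerSeries.coeff_one k

theorem Formal.coeff_algebraMap (k : ℕ) (r : ℝ) :
    Formal.coeff p V k (algebraMap ℝ _ r) = if k = 0 then algebraMap ℝ _ r else 0 := by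
  simp only [Algebra.algebraMap_eq_smul_one, map_smul, Formal.coeff_one, smul_ite, smul_zero]

theorem Formal.coeff_zero_eq_algebraMap_body (f : Formal p V) :
    Formal.coeff p V 0 f = algebraMap ℝ _ (Formal.body p V f) := by
  have hf : Formal.coeff p V 0 f ∈ (1 : Submodule ℝ (Sym p V)) := by
    simpa only [Sym.power, pow_zero] using Formal.coeff_mem f 0
  obtain ⟨r, hr⟩ := Submodule.mem_one.mp hf
  rw [Formal.body_eq, ← hr, AlgHom.commutes, Algebra.algebraMap_self_apply]

theorem Formal.body_algebraMap (r : ℝ) :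
    Formal.body p V (algebraMap ℝ (Formal p V) r) = r := by
  rw [Formal.body_eq, Formal.coeff_algebraMap, if_pos rfl, AlgHom.commutes,
    Algebra.algebraMap_self_apply]

theorem Formal.coeff_pow_eq_zero {h : Formal p V} (hh : Formal.body p V h = 0) {k n : ℕ}
    (hn : n < k) : Formal.coeff p V n (h ^ k) = 0 := by
  induction k generalizing n with
  | zero => exact absurd hn n.not_lt_zero
  | succ k ih =>
    rw [pow_succ, Formal.coeff_mul]
    refine Finset.sum_eq_zero fun q hq => ?_
    rw [Finset.HasAntidiagonal.mem_antidiagonal] at hq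
    rcases Nat.eq_zero_or_pos q.2 with h2 | h2
    · rw [h2, Formal.coeff_zero_eq_algebraMap_body, hh, map_zero, mul_zero]
    · rw [ih (by omega), zero_mul]

/-- The geometric series `∑ hᵏ` of a formal power series `h` with body `0`. Only finitely many
powers of such an `h` contribute to each coefficient, so the coefficient in `Sⁿ(V)` is taken from
the partial sum up to `hⁿ`. -/
def Formal.geom (h : Formal p V) : Formal p V :=
  ⟨PowerSeries.mk fun n => Formal.coeff p V n (∑ k ∈ Finset.range (n + 1), h ^ k), fun n => by
    rw [PowerSeries.coeff_mk]
    exact Formal.coeff_mem _ n⟩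

theorem Formal.coeff_geom (h : Formal p V) (n : ℕ) :
    Formal.coeff p V n (Formal.geom h) = Formal.coeff p V n (∑ k ∈ Finset.range (n + 1), h ^ k) :=
  PowerSeries.coeff_mk n fun n => Formal.coeff p V n (∑ k ∈ Finset.range (n + 1), h ^ k)

theorem Formal.coeff_geom_of_le {h : Formal p V} (hh : Formal.body p V h = 0) {k n : ℕ}
    (hk : k ≤ n) :
    Formal.coeff p V k (Formal.geom h) =
      Formal.coeff p V k (∑ j ∈ Finset.range (n + 1), h ^ j) := by
  rw [Formal.coeff_geom, map_sum, map_sum]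
  refine Finset.sum_subset (Finset.range_mono (by omega)) fun j _ hj => ?_
  exact Formal.coeff_pow_eq_zero hh (by simpa [Nat.lt_succ_iff] using hj)

theorem Formal.one_sub_mul_geom {h : Formal p V} (hh : Formal.body p V h = 0) :
    (1 - h) * Formal.geom h = 1 := by
  refine Formal.ext fun n => ?_
  calc Formal.coeff p V n ((1 - h) * Formal.geom h)
    _ = Formal.coeff p V n ((1 - h) * ∑ j ∈ Finset.range (n + 1), h ^ j) := by
      rw [Formal.coeff_mul, Formal.coeff_mul]
      refine Finset.sum_congr rfl fun q hq => ?_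
      rw [Formal.coeff_geom_of_le hh (Finset.HasAntidiagonal.antidiagonal.snd_le hq)]
    _ = Formal.coeff p V n 1 := by
      rw [mul_neg_geom_sum, map_sub, Formal.coeff_pow_eq_zero hh n.lt_succ_self, sub_zero]

theorem Formal.geom_mul_one_sub {h : Formal p V} (hh : Formal.body p V h = 0) :
    Formal.geom h * (1 - h) = 1 := by
  refine Formal.ext fun n => ?_
  calc Formal.coeff p V n (Formal.geom h * (1 - h))
    _ = Formal.coeff p V n ((∑ j ∈ Finset.range (n + 1), h ^ j) * (1 - h)) := by
      rw [Formal.coeff_mul, Formal.coeff_mul]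
      refine Finset.sum_congr rfl fun q hq => ?_
      rw [Formal.coeff_geom_of_le hh (Finset.HasAntidiagonal.antidiagonal.fst_le hq)]
    _ = Formal.coeff p V n 1 := by
      rw [geom_sum_mul_neg, map_sub, Formal.coeff_pow_eq_zero hh n.lt_succ_self, sub_zero]

end Formal

section Smooth

variable {I : Type u} [NonUnitalCommSemiring I] {p : I →+ ZMod 2} {V : GradedVectorSpace.{u, v} I}
  {n : ℕ} {M : Type u₁} [TopologicalSpace M] [ChartedSpace (EuclideanSpace ℝ (Fin n)) M]
  {U : Opens M}

theorem isUnit_smoothFunctions {a : smoothFunctions n M U} (ha : ∀ x, a.1 x ≠ 0) : IsUnit a :=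
  isUnit_iff_exists_inv.mpr ⟨⟨fun x => (a.1 x)⁻¹, a.2.inv₀ ha⟩,
    Subtype.ext (funext fun x => mul_inv_cancel₀ (ha x))⟩

theorem IsSmooth.algebraMap {a : U → ℝ} (ha : ContMDiff (𝓡 n) 𝓘(ℝ, ℝ) ∞ a) :
    IsSmooth n fun x => algebraMap ℝ (Formal p V) (a x) := by
  intro k l
  simp only [Formal.coeff_algebraMap]
  split_ifs
  · simp only [Algebra.algebraMap_eq_smul_one, map_smul, smul_eq_mul]
    exact ha.mul contMDiff_const
  · exact contMDiff_const

theorem IsSmooth.geom {f : U → Formal p V} (hf : IsSmooth n f) :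
    IsSmooth n fun x => Formal.geom (f x) := by
  intro k l
  have h : ∑ j ∈ Finset.range (k + 1), f ^ j ∈ smoothFormalFunctions n M p V U :=
    sum_mem fun j _ => pow_mem (show f ∈ smoothFormalFunctions n M p V U from hf) j
  simpa only [Formal.coeff_geom, Finset.sum_apply, Pi.pow_apply] using h k l

variable (p V U) in
/-- The smooth real functions on `U` as sections of degree `0` of the sheaf of smooth functions
with values in the formal power series on `V`. -/
def scalarSection : smoothFunctions n M U →+* smoothFormalFunctions n M p V U where
  toFun a := ⟨fun x => algebraMap ℝ (Formal p V) (a.1 x), IsSmooth.algebraMap a.2⟩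
  map_one' := Subtype.ext (funext fun _ => map_one _)
  map_mul' _ _ := Subtype.ext (funext fun _ => map_mul _ _ _)
  map_zero' := Subtype.ext (funext fun _ => map_zero _)
  map_add' _ _ := Subtype.ext (funext fun _ => map_add _ _ _)

theorem isUnit_of_body_eq_one {f : smoothFormalFunctions n M p V U}
    (hf : ∀ x, Formal.body p V (f.1 x) = 1) : IsUnit f := by
  let h := 1 - f
  have hh (x : U) : Formal.body p V (h.1 x) = 0 :=
    (map_sub (Formal.body p V) 1 (f.1 x)).trans (by rw [map_one, hf, sub_self])
  have isUnit_one_sub : IsUnit (1 - h) :=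
    ⟨⟨1 - h, ⟨_, IsSmooth.geom h.2⟩,
      Subtype.ext (funext fun x => Formal.one_sub_mul_geom (hh x)),
      Subtype.ext (funext fun x => Formal.geom_mul_one_sub (hh x))⟩, rfl⟩
  exact sub_sub_cancel 1 f ▸ isUnit_one_sub

theorem isUnit_of_body_ne_zero {f : smoothFormalFunctions n M p V U}
    (hf : ∀ x, Formal.body p V (f.1 x) ≠ 0) : IsUnit f := by
  obtain ⟨b, hb⟩ : IsUnit (show smoothFunctions n M U from (canonicalBody n M p V).app U f) :=
    isUnit_smoothFunctions hf
  have body_eq_one (x : U) : Formal.body p V ((scalarSection p V U ↑b⁻¹ * f).1 x) = 1 := by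
    have inv_mul_body : (b⁻¹.1).1 x * Formal.body p V (f.1 x) = 1 := by
      have h := congrArg (fun a : smoothFunctions n M U => a.1 x) b.inv_mul
      rwa [hb] at h
    calc Formal.body p V ((scalarSection p V U ↑b⁻¹ * f).1 x)
      _ = Formal.body p V (algebraMap ℝ (Formal p V) ((b⁻¹.1).1 x) * f.1 x) := rfl
      _ = 1 := by rw [map_mul, Formal.body_algebraMap, inv_mul_body]
  have hf_eq : f = scalarSection p V U b * (scalarSection p V U ↑b⁻¹ * f) := by
    rw [← mul_assoc, ← map_mul, b.mul_inv, map_one, one_mul]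
  exact hf_eq ▸ (b.isUnit.map _).mul (isUnit_of_body_eq_one body_eq_one)

end Smooth

section Body

variable {I : Type u} [NonUnitalCommSemiring I] {n : ℕ} {M : Type u₁} [TopologicalSpace M]
  [ChartedSpace (EuclideanSpace ℝ (Fin n)) M]

/-- Evaluation of smooth functions at a point. -/
def smoothSpace.character (x : M) : StalkCharacter (smoothSpace I n M) x where
  eval U hx := (Pi.evalRingHom (fun _ : U => ℝ) ⟨x, hx⟩).comp
    (smoothFunctions n M U).val.toRingHom
  eval_res _ _ _ := rfl

/-- The value at a point of the image under a body map, as a character of the stalk. -/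
def BodyMap.character {O : GradedRingedSpace.{u, w} I M} (ε : BodyMap n O) (x : M) :
    StalkCharacter O x :=
  (smoothSpace.character x).map ε.embedding

theorem BodyMap.character_eval {O : GradedRingedSpace.{u, w} I M} (ε : BodyMap n O) {x : M}
    {U : Opens M} (hx : x ∈ U) (f : O.sec U) : (ε.character x).eval U hx f = ε.val f x hx :=
  rfl

theorem BodyMap.subsingleton {O : GradedRingedSpace.{u, w} I M}
    (hO : ∀ x, Subsingleton (StalkCharacter O x)) : Subsingleton (BodyMap n O) where
  allEq ε ε' := BodyMap.ext <| funext fun U => RingHom.ext fun f => Subtype.ext <|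
    funext fun x => congrArg (fun χ => χ.eval U x.2 f)
      ((hO x).elim (ε.character x.1) (ε'.character x.1))

theorem BodyMap.contMDiff_val {O : GradedRingedSpace.{u, w} I M} (ε : BodyMap n O) {U : Opens M}
    (f : O.sec U) : ContMDiff (𝓡 n) 𝓘(ℝ, ℝ) ∞ fun x : U => ε.val f x x.2 :=
  (show smoothFunctions n M U from ε.app U f).2

variable {p : I →+ ZMod 2} {V : GradedVectorSpace.{u, v} I}

theorem canonicalBody_val_scalarSection {U : Opens M} (a : smoothFunctions n M U) {x : M}
    (hx : x ∈ U) :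
    (canonicalBody n M p V).val (U := U) (scalarSection p V U a) x hx = a.1 ⟨x, hx⟩ :=
  Formal.body_algebraMap _

theorem GradedRingedSpace.StalkCharacter.eval_eq_canonicalBody_val {x : M}
    (χ : StalkCharacter (smoothFormalSpace n M p V) x) {U : Opens M} (hx : x ∈ U)
    (f : (smoothFormalSpace n M p V).sec U) :
    χ.eval U hx f = (canonicalBody n M p V).val f x hx := by
  let O := smoothFormalSpace n M p V
  let ε := canonicalBody n M p V
  by_contra hne
  let g : O.sec U := f - algebraMap ℝ (O.sec U) (χ.eval U hx f)
  have eval_g : χ.eval U hx g = 0 := by rw [map_sub, χ.eval_algebraMap, sub_self]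
  have val_g : ε.val g x hx ≠ 0 := by
    rw [← BodyMap.character_eval, map_sub, StalkCharacter.eval_algebraMap, sub_ne_zero]
    exact Ne.symm hne
  let nonvanishing : Opens M :=
    openImage U ⟨{y | ε.val g y y.2 ≠ 0}, isOpen_ne_fun (ε.contMDiff_val g).continuous
      continuous_const⟩
  have hle : nonvanishing ≤ U := fun y hy => (mem_openImage.mp hy).1
  have isUnit_res : IsUnit (O.res hle g) :=
    isUnit_of_body_ne_zero (U := nonvanishing) fun y => (mem_openImage.mp y.2).2
  have := isUnit_res.map (χ.eval nonvanishing (mem_openImage.mpr ⟨hx, val_g⟩))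
  rw [χ.eval_res, eval_g] at this
  exact not_isUnit_zero this

end Body

namespace GradedChart

variable {I : Type u} [NonUnitalCommSemiring I] {n : ℕ} {M : Type u₁} [TopologicalSpace M]
  [ChartedSpace (EuclideanSpace ℝ (Fin n)) M] {p : I →+ ZMod 2} {V : GradedVectorSpace.{u, v} I}
  {O : GradedRingedSpace.{u, w} I M} (c : GradedChart (n := n) p V O)

/-- The part of `M` that corresponds to the open set `T` of the graded domain under the chart. -/
def preimage (T : Opens c.target) : Opens M := openImage c.source (Opens.comap c.map.base T)

/-- The inverse of a chart, as a morphism from the graded domain to `(M, O)`. -/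
def param : Hom (gradedDomain p V c.target) O := (Hom.ofRestrict O c.source).comp c.isIso.inv

theorem param_base_apply (x : c.source) : c.param.base (c.map.base x) = x :=
  congrArg Subtype.val (c.isIso.invBase_base x)

theorem param_base_mem_source (y : c.target) : c.param.base y ∈ c.source :=
  (c.isIso.invBase y).2

theorem preimage_comap_param_le (U : Opens M) : c.preimage (Opens.comap c.param.base U) ≤ U :=
  (openImage_mono (c.isIso.comap_base_comap_invBase_le _)).trans (openImage_comap_val_le _ U)

theorem map_app_param_app (U : Opens M) (f : O.sec U) :
    c.map.app _ (c.param.app U f) = O.res (c.preimage_comap_param_le U) f :=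
  (c.isIso.app_invApp _ (O.res (openImage_comap_val_le c.source U) f)).trans
    (O.res_res (openImage_mono (c.isIso.comap_base_comap_invBase_le _))
      (openImage_comap_val_le c.source U) f)

theorem eval_map_app {x : c.source} (χ : StalkCharacter O x.1) {T : Opens c.target}
    (hx : c.map.base x ∈ T) (g : (gradedDomain p V c.target).sec T) :
    χ.eval (c.preimage T) (mem_openImage.mpr ⟨x.2, hx⟩) (c.map.app T g) =
      (canonicalBody n c.target p V).val g (c.map.base x) hx :=
  (χ.restrict.map c.map).eval_eq_canonicalBody_val hx g

theorem map_base_mem_comap_param {x : c.source} {U : Opens M} (hx : x.1 ∈ U) :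
    c.map.base x ∈ Opens.comap c.param.base U :=
  show c.param.base (c.map.base x) ∈ U from (c.param_base_apply x).symm ▸ hx

theorem eval_eq {x : c.source} (χ : StalkCharacter O x.1) {U : Opens M} (hx : x.1 ∈ U)
    (f : O.sec U) :
    χ.eval U hx f = (canonicalBody n c.target p V).val (c.param.app U f) (c.map.base x)
      (c.map_base_mem_comap_param hx) := by
  have hx' := c.map_base_mem_comap_param hx
  have mem_preimage : x.1 ∈ c.preimage (Opens.comap c.param.base U) :=
    mem_openImage.mpr ⟨x.2, hx'⟩
  calc
    χ.eval U hx f = χ.eval _ mem_preimage (O.res (c.preimage_comap_param_le U) f) :=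
      (χ.eval_res (c.preimage_comap_param_le U) mem_preimage f).symm
    _ = χ.eval _ mem_preimage (c.map.app _ (c.param.app U f)) :=
      congrArg (χ.eval _ mem_preimage) (c.map_app_param_app U f).symm
    _ = _ := c.eval_map_app χ hx' _

theorem contMDiff_map_base : ContMDiff (𝓡 n) (𝓡 n) ∞ c.map.base := by
  obtain ⟨e, he⟩ := c.isDiffeo
  exact he ▸ e.contMDiff

theorem contMDiff_param_base : ContMDiff (𝓡 n) (𝓡 n) ∞ c.param.base := by
  obtain ⟨e, he⟩ := c.isDiffeo
  have param_eq (y : c.target) : (e.symm y : M) = c.param.base y := by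
    rw [← c.param_base_apply, ← he, e.apply_symm_apply]
  exact (contMDiff_subtype_val.comp e.symm.contMDiff).congr fun y => (param_eq y).symm

end GradedChart

section Manifold

variable {I : Type u} [NonUnitalCommSemiring I] {n : ℕ} {M : Type u₁} [TopologicalSpace M]
  [ChartedSpace (EuclideanSpace ℝ (Fin n)) M] {p : I →+ ZMod 2} {V : GradedVectorSpace.{u, v} I}
  {O : GradedRingedSpace.{u, w} I M}

theorem mem_grade_smoothSpace {U : Opens M} {f : smoothFunctions n M U} {i : I}
    (hf : i ≠ 0 → f = 0) : f ∈ (smoothSpace I n M).grade U i := by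
  classical
  change f ∈ (if i = 0 then ⊤ else ⊥ : Submodule ℝ (smoothFunctions n M U))
  split_ifs with hi
  · exact Submodule.mem_top
  · exact (Submodule.mem_bot ℝ).mpr (hf hi)

theorem BodyMap.isCanonical (ε : BodyMap n O) : ε.IsCanonical p V := fun c _ g x hx =>
  c.eval_map_app (ε.character x) hx g

namespace IsGradedManifold

variable (hO : IsGradedManifold (n := n) p V O)
include hO

theorem subsingleton_stalkCharacter (x : M) : Subsingleton (StalkCharacter O x) where
  allEq χ χ' := by
    obtain ⟨c, hx⟩ := hO x
    refine StalkCharacter.ext (funext fun U => funext fun hxU => RingHom.ext fun f => ?_)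
    exact (c.eval_eq (x := ⟨x, hx⟩) χ hxU f).trans (c.eval_eq (x := ⟨x, hx⟩) χ' hxU f).symm

theorem nonempty_stalkCharacter (x : M) : Nonempty (StalkCharacter O x) := by
  obtain ⟨c, hx⟩ := hO x
  have param_base_eq : c.param.base (c.map.base ⟨x, hx⟩) = x := c.param_base_apply ⟨x, hx⟩
  exact param_base_eq ▸
    ⟨((canonicalBody n c.target p V).character (c.map.base ⟨x, hx⟩)).map c.param⟩

theorem contMDiff_eval (χ : ∀ x, StalkCharacter O x) (U : Opens M) (f : O.sec U) :
    ContMDiff (𝓡 n) 𝓘(ℝ, ℝ) ∞ fun x : U => (χ x.1).eval U x.2 f := by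
  refine contMDiff_of_locally _ fun x => ?_
  obtain ⟨c, hx⟩ := hO x.1
  let T := Opens.comap c.param.base U
  have mem_source (y : c.preimage T) : y.1 ∈ c.source := (mem_openImage.mp y.2).1
  let chart (y : c.preimage T) : T := ⟨c.map.base ⟨y.1, mem_source y⟩, (mem_openImage.mp y.2).2⟩
  have contMDiff_chart : ContMDiff (𝓡 n) (𝓡 n) ∞ chart :=
    (ContMDiff.subtypeVal_comp_iff T chart).mp
      (c.contMDiff_map_base.comp (contMDiff_inclusion fun y hy => mem_source ⟨y, hy⟩))
  refine ⟨c.preimage T, mem_openImage.mpr ⟨hx, c.map_base_mem_comap_param x.2⟩,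
    c.preimage_comap_param_le U, ?_⟩
  exact (((canonicalBody n c.target p V).contMDiff_val (c.param.app U f)).comp
    contMDiff_chart).congr fun y => c.eval_eq (x := ⟨y.1, mem_source y⟩) (χ y.1) _ f

theorem eval_eq_zero_of_mem_grade {x : M} (χ : StalkCharacter O x) {U : Opens M} (hx : x ∈ U)
    {f : O.sec U} {i : I} (hf : f ∈ O.grade U i) (hi : i ≠ 0) : χ.eval U hx f = 0 := by
  obtain ⟨c, hxc⟩ := hO x
  exact (c.eval_eq (x := ⟨x, hxc⟩) χ hx f).trans
    (Formal.body_eq_zero hi (c.param.app_mem U hf _))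

theorem nonempty_bodyMap : Nonempty (BodyMap n O) := by
  let χ (x : M) := (hO.nonempty_stalkCharacter x).some
  exact ⟨{
    app U :=
      { toFun f := (⟨fun x => (χ x.1).eval U x.2 f, hO.contMDiff_eval χ U f⟩ :
          smoothFunctions n M U)
        map_one' := Subtype.ext (funext fun _ => map_one _)
        map_mul' _ _ := Subtype.ext (funext fun _ => map_mul _ _ _)
        map_zero' := Subtype.ext (funext fun _ => map_zero _)
        map_add' _ _ := Subtype.ext (funext fun _ => map_add _ _ _) }
    naturality h f := Subtype.ext (funext fun x => (χ x.1).eval_res h x.2 f)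
    app_mem _ _ _ hf := mem_grade_smoothSpace fun hi =>
      Subtype.ext (funext fun x => hO.eval_eq_zero_of_mem_grade (χ x.1) x.2 hf hi) }⟩

theorem subsingleton_bodyMap : Subsingleton (BodyMap n O) :=
  BodyMap.subsingleton hO.subsingleton_stalkCharacter

end IsGradedManifold

end Manifold

section Domain

variable {I : Type u} [NonUnitalCommSemiring I] {n : ℕ} {p : I →+ ZMod 2}
  {V : GradedVectorSpace.{u, v} I}

theorem isGradedManifold_gradedDomain (D : Opens (EuclideanSpace ℝ (Fin n))) :
    IsGradedManifold (n := n) p V (gradedDomain p V D) := fun _ =>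
  ⟨{ source := ⊤
     target := D
     map := Hom.ofRestrict _ ⊤
     isIso := Hom.isIso_ofRestrict_top _
     isDiffeo := ⟨
      { toEquiv := Equiv.Set.univ D
        contMDiff_toFun := contMDiff_subtype_val
        contMDiff_invFun :=
          (ContMDiff.subtypeVal_comp_iff (⊤ : Opens D) fun y => ⟨y, trivial⟩).mp contMDiff_id },
      rfl⟩ }, trivial⟩

end Domain

section Separation

variable {I : Type u} [NonUnitalCommSemiring I] {n : ℕ} {M : Type u₁} [TopologicalSpace M]
  [ChartedSpace (EuclideanSpace ℝ (Fin n)) M] {p : I →+ ZMod 2} {V : GradedVectorSpace.{u, v} I}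
  {O : GradedRingedSpace.{u, w} I M}

namespace GradedChart

variable (c : GradedChart (n := n) p V O)

theorem eval_map_app_scalarSection {x : c.source} (χ : StalkCharacter O x.1) {T : Opens c.target}
    (hx : c.map.base x ∈ T) (a : smoothFunctions n c.target T) :
    χ.eval (c.preimage T) (mem_openImage.mpr ⟨x.2, hx⟩) (c.map.app T (scalarSection p V T a)) =
      a.1 ⟨c.map.base x, hx⟩ :=
  (c.eval_map_app χ hx _).trans (canonicalBody_val_scalarSection a hx)

theorem res_map_app_scalarSection_eq_zero (a : smoothFunctions n c.target ⊤)
    {T : Opens c.target} (ha : ∀ y : T, a.1 ⟨y.1, trivial⟩ = 0) {U : Opens M}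
    (hU : U ≤ c.preimage ⊤) (hUT : U ≤ c.preimage T) :
    O.res hU (c.map.app ⊤ (scalarSection p V ⊤ a)) = 0 := by
  have res_scalarSection :
      (gradedDomain p V c.target).res (le_top : T ≤ ⊤) (scalarSection p V ⊤ a) = 0 :=
    Subtype.ext (funext fun y => (congrArg (algebraMap ℝ (Formal p V)) (ha y)).trans (map_zero _))
  have res_preimage : O.res (openImage_mono (Opens.comap_mono c.map.base le_top))
      (c.map.app ⊤ (scalarSection p V ⊤ a)) = (0 : O.sec (c.preimage T)) :=
    (c.map.naturality (le_top : T ≤ ⊤) _).symm.trans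
      ((congrArg (c.map.app T) res_scalarSection).trans (map_zero (c.map.app T)))
  calc O.res hU (c.map.app ⊤ (scalarSection p V ⊤ a))
    _ = O.res hUT (O.res (openImage_mono (Opens.comap_mono c.map.base le_top))
        (c.map.app ⊤ (scalarSection p V ⊤ a))) := (O.res_res hUT _ _).symm
    _ = 0 := by rw [res_preimage, map_zero]

theorem exists_extend_by_zero [T2Space M] (a : smoothFunctions n c.target ⊤) {K : Set c.target}
    (hK : IsCompact K) (ha : ∀ y ∉ K, a.1 ⟨y, trivial⟩ = 0) :
    ∃ s : O.sec ⊤, O.res le_top s = c.map.app ⊤ (scalarSection p V ⊤ a) ∧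
      ∀ (U : Opens M), Disjoint (U : Set M) (c.param.base '' K) → O.res (le_top : U ≤ ⊤) s = 0 := by
  let outside : Opens M :=
    ⟨(c.param.base '' K)ᶜ, (hK.image c.param.base.continuous).isClosed.isOpen_compl⟩
  have mem_preimage_of_mem_source {x : M} (hx : x ∈ c.source) : x ∈ c.preimage ⊤ :=
    mem_openImage.mpr ⟨hx, trivial⟩
  have cover : c.preimage ⊤ ⊔ outside = ⊤ := eq_top_iff.mpr fun x _ => by
    by_cases hx : x ∈ c.param.base '' K
    · obtain ⟨y, -, rfl⟩ := hx
      exact Or.inl (mem_preimage_of_mem_source (c.param_base_mem_source y))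
    · exact Or.inr hx
  have le_preimage_compl :
      c.preimage ⊤ ⊓ outside ≤ c.preimage ⟨Kᶜ, hK.isClosed.isOpen_compl⟩ := fun x hx => by
    obtain ⟨hx_source, -⟩ := mem_openImage.mp hx.1
    exact mem_openImage.mpr ⟨hx_source, fun hxK =>
      hx.2 ⟨_, hxK, c.param_base_apply ⟨x, hx_source⟩⟩⟩
  obtain ⟨s, hs, hs_outside⟩ := exists_glue cover (c.map.app ⊤ (scalarSection p V ⊤ a)) 0
    ((c.res_map_app_scalarSection_eq_zero a (fun y => ha y.1 y.2) inf_le_left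
      le_preimage_compl).trans (map_zero _).symm)
  refine ⟨s, hs, fun U hU => ?_⟩
  have hU_outside : U ≤ outside := hU.subset_compl_right
  rw [← O.res_res hU_outside le_top, hs_outside, map_zero]

end GradedChart

theorem IsGradedManifold.exists_separating_section [T2Space M]
    (hO : IsGradedManifold (n := n) p V O) {x y : M} (hxy : x ≠ y) :
    ∃ s : O.sec ⊤, (∀ χ : StalkCharacter O x, χ.eval ⊤ trivial s = 1) ∧
      ∀ χ : StalkCharacter O y, χ.eval ⊤ trivial s = 0 := by
  obtain ⟨c, hx⟩ := hO x
  let x' := c.map.base ⟨x, hx⟩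
  have param_x' : c.param.base x' = x := c.param_base_apply ⟨x, hx⟩
  obtain ⟨b, -, hb⟩ := (SmoothBumpFunction.nhds_basis_tsupport (I := 𝓡 n) x').mem_iff.mp
    (c.param.base.continuous.continuousAt.preimage_mem_nhds
      (isOpen_compl_singleton.mem_nhds (param_x' ▸ hxy : c.param.base x' ∈ ({y} : Set M)ᶜ)))
  let bump : smoothFunctions n c.target ⊤ :=
    ⟨fun z => b z.1, b.contMDiff.comp contMDiff_subtype_val⟩
  obtain ⟨s, hs, hs_disjoint⟩ := c.exists_extend_by_zero bump b.hasCompactSupport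
    fun _ => image_eq_zero_of_notMem_tsupport
  refine ⟨s, fun χ => ?_, fun χ => ?_⟩
  · have mem_preimage : x ∈ c.preimage ⊤ := mem_openImage.mpr ⟨hx, trivial⟩
    calc χ.eval ⊤ trivial s
      _ = χ.eval _ mem_preimage (O.res le_top s) := (χ.eval_res le_top mem_preimage s).symm
      _ = χ.eval _ mem_preimage (c.map.app ⊤ (scalarSection p V ⊤ bump)) := congrArg _ hs
      _ = b x' := c.eval_map_app_scalarSection (x := ⟨x, hx⟩) χ (T := ⊤) trivial bump
      _ = 1 := b.eq_one
  · have isClosed_image := (b.hasCompactSupport.image c.param.base.continuous).isClosed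
    have mem_outside : y ∉ c.param.base '' tsupport b := fun ⟨z, hz, hzy⟩ => hb hz hzy
    rw [← χ.eval_res le_top (U := ⟨_, isClosed_image.isOpen_compl⟩) mem_outside,
      hs_disjoint _ disjoint_compl_left, map_zero]

end Separation

section Morphism

variable {I : Type u} [NonUnitalCommSemiring I] {m n : ℕ}
  {M : Type u₁} [TopologicalSpace M] [ChartedSpace (EuclideanSpace ℝ (Fin m)) M]
  {N : Type u₂} [TopologicalSpace N] [ChartedSpace (EuclideanSpace ℝ (Fin n)) N]
  {𝓜 : GradedRingedSpace.{u, w₁} I M} {𝓝 : GradedRingedSpace.{u, w₂} I N}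

namespace BodyMap

theorem val_app (h𝓝 : ∀ y, Subsingleton (StalkCharacter 𝓝 y)) (ε₁ : BodyMap m 𝓜)
    (ε₂ : BodyMap n 𝓝) (φ : Hom 𝓜 𝓝) {U : Opens N} (f : 𝓝.sec U) {x : M}
    (hx : φ.base x ∈ U) : ε₁.val (φ.app U f) x hx = ε₂.val f (φ.base x) hx :=
  congrArg (fun χ => χ.eval U hx f)
    ((h𝓝 (φ.base x)).elim ((ε₁.character x).map φ) (ε₂.character (φ.base x)))

theorem comp_embedding (h𝓝 : ∀ y, Subsingleton (StalkCharacter 𝓝 y)) (ε₁ : BodyMap m 𝓜)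
    (ε₂ : BodyMap n 𝓝) (φ : Hom 𝓜 𝓝) (hφ : ContMDiff (𝓡 m) (𝓡 n) ∞ φ.base) :
    φ.comp ε₁.embedding = ε₂.embedding.comp (smoothHom φ.base hφ) :=
  Hom.ext rfl <| heq_of_eq <| funext fun _ => RingHom.ext fun f => Subtype.ext <|
    funext fun x => val_app h𝓝 ε₁ ε₂ φ f x.2

end BodyMap

variable {q : I →+ ZMod 2} {W : GradedVectorSpace.{u, v} I}

theorem contMDiff_euclideanSpace {E H X ι : Type*} [NormedAddCommGroup E] [NormedSpace ℝ E]
    [TopologicalSpace H] {J : ModelWithCorners ℝ E H} [TopologicalSpace X] [ChartedSpace H X]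
    [Fintype ι] {k : ℕ∞ω} {f : X → EuclideanSpace ℝ ι}
    (hf : ∀ j, ContMDiff J 𝓘(ℝ, ℝ) k fun x => f x j) :
    ContMDiff J 𝓘(ℝ, EuclideanSpace ℝ ι) k f :=
  (EuclideanSpace.equiv ι ℝ).symm.contDiff.contMDiff.comp (contMDiff_pi_space.mpr hf)

theorem GradedChart.contMDiff_map_base_comp (c : GradedChart (n := n) q W 𝓝) (ε : BodyMap m 𝓜)
    (φ : Hom 𝓜 𝓝) :
    ContMDiff (𝓡 m) (𝓡 n) ∞ fun x : Opens.comap φ.base (c.preimage ⊤) =>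
      c.map.base ⟨φ.base x, (mem_openImage.mp x.2).1⟩ := by
  refine (ContMDiff.subtypeVal_comp_iff _ _).mp (contMDiff_euclideanSpace fun j => ?_)
  let coordinate : smoothFunctions n c.target ⊤ := ⟨fun y => y.1.1 j,
    (EuclideanSpace.proj j : EuclideanSpace ℝ (Fin n) →L[ℝ] ℝ).contDiff.contMDiff.comp
      (contMDiff_subtype_val.comp contMDiff_subtype_val)⟩
  exact (ε.contMDiff_val (φ.app _ (c.map.app ⊤ (scalarSection q W ⊤ coordinate)))).congr fun x =>
    (c.eval_map_app_scalarSection (x := ⟨φ.base x, (mem_openImage.mp x.2).1⟩)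
      ((ε.character x.1).map φ) (T := ⊤) trivial coordinate).symm

namespace IsGradedManifold

variable (h𝓝 : IsGradedManifold (n := n) q W 𝓝)
include h𝓝

theorem contMDiff_base (ε : BodyMap m 𝓜) (φ : Hom 𝓜 𝓝) :
    ContMDiff (𝓡 m) (𝓡 n) ∞ φ.base := fun x => by
  obtain ⟨c, hx⟩ := h𝓝 (φ.base x)
  have mem_comap : x ∈ Opens.comap φ.base (c.preimage ⊤) := mem_openImage.mpr ⟨hx, trivial⟩
  have contMDiff_restrict : ContMDiff (𝓡 m) (𝓡 n) ∞
      fun z : Opens.comap φ.base (c.preimage ⊤) => φ.base z :=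
    (c.contMDiff_param_base.comp (c.contMDiff_map_base_comp ε φ)).congr fun z =>
      (c.param_base_apply ⟨φ.base z, (mem_openImage.mp z.2).1⟩).symm
  exact contMDiffAt_subtype_iff.mp (contMDiff_restrict ⟨x, mem_comap⟩)

theorem exists_comp_embedding_eq (ε₁ : BodyMap m 𝓜) (ε₂ : BodyMap n 𝓝) (φ : Hom 𝓜 𝓝) :
    ∃ hφ : ContMDiff (𝓡 m) (𝓡 n) ∞ φ.base,
      φ.comp ε₁.embedding = ε₂.embedding.comp (smoothHom φ.base hφ) :=
  ⟨h𝓝.contMDiff_base ε₁ φ, ε₁.comp_embedding h𝓝.subsingleton_stalkCharacter ε₂ φ _⟩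

theorem base_eq_of_globalPullback_eq [T2Space N] (h𝓜 : ∀ x, Nonempty (StalkCharacter 𝓜 x))
    {φ ψ : Hom 𝓜 𝓝} (h : φ.globalPullback = ψ.globalPullback) : φ.base = ψ.base := by
  refine ContinuousMap.ext fun x => by_contra fun hne => ?_
  obtain ⟨χ⟩ := h𝓜 x
  obtain ⟨s, hs_one, hs_zero⟩ := h𝓝.exists_separating_section hne
  refine zero_ne_one (α := ℝ) ?_
  calc 0 = χ.eval ⊤ trivial (ψ.globalPullback s) := (hs_zero (χ.map ψ)).symm
    _ = χ.eval ⊤ trivial (φ.globalPullback s) := by rw [h]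
    _ = 1 := hs_one (χ.map φ)

end IsGradedManifold

end Morphism

end MonoidallyGraded

end

theorem mainTheorem5_general {I : Type*} [NonUnitalCommSemiring I]
    (p q : I →+ ZMod 2) {m n : ℕ}
    (V : GradedVectorSpace I) (W : GradedVectorSpace I)
    {M : Type*} [TopologicalSpace M] [ChartedSpace (EuclideanSpace ℝ (Fin m)) M]
    {N : Type*} [TopologicalSpace N] [T2Space N] [ChartedSpace (EuclideanSpace ℝ (Fin n)) N]
    (𝓜 : GradedRingedSpace I M) (h𝓜 : IsGradedManifold (n := m) p V 𝓜)
    (𝓝 : GradedRingedSpace I N) (h𝓝 : IsGradedManifold (n := n) q W 𝓝) :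
    (∃ (εM : BodyMap m 𝓜) (εN : BodyMap n 𝓝),
      (εM.IsCanonical p V ∧ ∀ ε : BodyMap m 𝓜, ε = εM) ∧
      (εN.IsCanonical q W ∧ ∀ ε : BodyMap n 𝓝, ε = εN) ∧
      (∀ φ : Hom 𝓜 𝓝,
        (∀ (U : Opens N) (f : 𝓝.sec U) (x : M) (hx : φ.base x ∈ U),
          εM.val (φ.app U f) x hx = εN.val f (φ.base x) hx) ∧
        ∃ hφ : ContMDiff (𝓡 m) (𝓡 n) ∞ φ.base,
          φ.comp εM.embedding = εN.embedding.comp (smoothHom φ.base hφ)) ∧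
      ∀ φ ψ : Hom 𝓜 𝓝, φ.globalPullback = ψ.globalPullback → φ.base = ψ.base) ∧
    ∀ (D : Opens (EuclideanSpace ℝ (Fin m))) (E : Opens (EuclideanSpace ℝ (Fin n))),
      (∀ φ : Hom (gradedDomain p V D) (gradedDomain q W E),
        (∀ (U : Opens E) (f : (gradedDomain q W E).sec U) (x : D) (hx : φ.base x ∈ U),
          (canonicalBody m D p V).val (φ.app U f) x hx =
            (canonicalBody n E q W).val f (φ.base x) hx) ∧
        ∃ hφ : ContMDiff (𝓡 m) (𝓡 n) ∞ φ.base,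
          φ.comp (canonicalBody m D p V).embedding =
            (canonicalBody n E q W).embedding.comp (smoothHom φ.base hφ)) ∧
      ∀ φ ψ : Hom (gradedDomain p V D) (gradedDomain q W E),
        φ.globalPullback = ψ.globalPullback → φ.base = ψ.base := by
  refine ⟨?_, fun D E => ?_⟩
  · obtain ⟨εM⟩ := h𝓜.nonempty_bodyMap
    obtain ⟨εN⟩ := h𝓝.nonempty_bodyMap
    exact ⟨εM, εN, ⟨εM.isCanonical, fun ε => h𝓜.subsingleton_bodyMap.elim ε εM⟩,
      ⟨εN.isCanonical, fun ε => h𝓝.subsingleton_bodyMap.elim ε εN⟩,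
      fun φ => ⟨fun _ f _ hx => εM.val_app h𝓝.subsingleton_stalkCharacter εN φ f hx,
        h𝓝.exists_comp_embedding_eq εM εN φ⟩,
      fun _ _ => h𝓝.base_eq_of_globalPullback_eq fun x => ⟨εM.character x⟩⟩
  · let εD := canonicalBody m D p V
    let εE := canonicalBody n E q W
    have hE : IsGradedManifold q W (gradedDomain q W E) := isGradedManifold_gradedDomain E
    exact ⟨fun φ => ⟨fun _ f _ hx => εD.val_app hE.subsingleton_stalkCharacter εE φ f hx,
        hE.exists_comp_embedding_eq εD εE φ⟩,
      fun _ _ => hE.base_eq_of_globalPullback_eq fun x => ⟨εD.character x⟩⟩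

theorem mainTheorem5 {I : Type*} [NonUnitalCommSemiring I] [IsCancelAdd I] [Countable I]
    (p : I →+ ZMod 2) (hp : p ≠ 0) {m n : ℕ}
    (V : GradedVectorSpace I) (W : GradedVectorSpace I)
    {M : Type*} [TopologicalSpace M] [T2Space M] [ChartedSpace (EuclideanSpace ℝ (Fin m)) M]
    [IsManifold (𝓡 m) ∞ M]
    {N : Type*} [TopologicalSpace N] [T2Space N] [ChartedSpace (EuclideanSpace ℝ (Fin n)) N]
    [IsManifold (𝓡 n) ∞ N]
    (𝓜 : GradedRingedSpace I M) (h𝓜 : IsGradedManifold (n := m) p V 𝓜)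
    (𝓝 : GradedRingedSpace I N) (h𝓝 : IsGradedManifold (n := n) p W 𝓝) :
    -- graded manifolds
    (∃ (εM : BodyMap m 𝓜) (εN : BodyMap n 𝓝),
      (εM.IsCanonical p V ∧ ∀ ε : BodyMap m 𝓜, ε = εM) ∧
      (εN.IsCanonical p W ∧ ∀ ε : BodyMap n 𝓝, ε = εN) ∧
      (∀ φ : Hom 𝓜 𝓝,
        (∀ (U : Opens N) (f : 𝓝.sec U) (x : M) (hx : φ.base x ∈ U),
          εM.val (φ.app U f) x hx = εN.val f (φ.base x) hx) ∧
        ∃ hφ : ContMDiff (𝓡 m) (𝓡 n) ∞ φ.base,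
          φ.comp εM.embedding = εN.embedding.comp (smoothHom φ.base hφ)) ∧
      ∀ φ ψ : Hom 𝓜 𝓝, φ.globalPullback = ψ.globalPullback → φ.base = ψ.base) ∧
    -- graded domains, with their canonical body maps
    ∀ (D : Opens (EuclideanSpace ℝ (Fin m))) (E : Opens (EuclideanSpace ℝ (Fin n))),
      (∀ φ : Hom (gradedDomain p V D) (gradedDomain p W E),
        (∀ (U : Opens E) (f : (gradedDomain p W E).sec U) (x : D) (hx : φ.base x ∈ U),
          (canonicalBody m D p V).val (φ.app U f) x hx =
            (canonicalBody n E p W).val f (φ.base x) hx) ∧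
        ∃ hφ : ContMDiff (𝓡 m) (𝓡 n) ∞ φ.base,
          φ.comp (canonicalBody m D p V).embedding =
            (canonicalBody n E p W).embedding.comp (smoothHom φ.base hφ)) ∧
      ∀ φ ψ : Hom (gradedDomain p V D) (gradedDomain p W E),
        φ.globalPullback = ψ.globalPullback → φ.base = ψ.base :=
  mainTheorem5_general p p V W 𝓜 h𝓜 𝓝 h𝓝
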